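/- Let $d\ge 1$ be an integer and let $0<\alpha\le 1$, $\beta>0$, $L>1$ and $C\ge 2^{\beta}$ be real numbers with $\alpha\beta\le d$. Let $\mathcal P(\alpha,\beta)$ be the set of all probability distributions $P$ of a pair $(X,Y)\in\mathbb R^d\times\{0,1\}$, with marginal distribution $P_X$ of $X$ and regression function $\eta(x)=P(Y=1\mid X=x)$, such that $\operatorname{supp}(P_X)\subset[0,1]^d$ and (i) $|\eta(x)-\eta(x')|\le L\,P_X\big(B(x,\|x-x'\|)\big)^{\alpha/d}$ for all $x,x'\in\operatorname{supp}(P_X)$, where $B(x,r)$ is the open Euclidean ball and $\|\cdot\|$ the Euclidean norm; (ii) $P_X\big(\{x:|\eta(x)-\tfrac12|<\varepsilon\}\big)<C\varepsilon^{\beta}$ for all $0<\varepsilon\le 1$. For a classifier $f:\mathbb R^d\to\{0,1\}$ let $R(f)=P(f(X)\ne Y)$, and let $f^*=\mathbf 1_{\{\eta\ge 1/2\}}$ be the Bayes classifier. An active classifier $\widehat f_{n,w}$ with label budget $n$ observes a pool $X_1,\dots,X_w$ of unlabelled points, where $(X_1,Y_1),\dots,(X_w,Y_w)$ are i.i.d.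 from $P$, requests one after the other at most $n$ of the labels $Y_i$, each choice depending on the pool, on the labels revealed before and possibly on an independent random seed, and then returns a classifier; it may also use knowledge of $P_X$. Then there are a constant $\gamma>0$ and an integer $N$, depending only on $d,\alpha,\beta,L,C$, such that for all $n\ge N$, all pool sizes $w$ and all active classifiers $\widehat f_{n,w}$ with label budget $n$, $$\sup_{P\in\mathcal P(\alpha,\beta)}\mathbb E\big[R(\widehat f_{n,w})-R(f^*)\big]\ \ge\ \gamma\, n^{-\frac{\alpha(\beta+1)}{2\alpha+d-\alpha\beta}} ,$$ where the expectation is over the sample $(X_1,Y_1),\dots,(X_w,Y_w)$ and the seed. -/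

import Mathlib

open MeasureTheory

/-- The ambient space `ℝ^d` with the Euclidean metric and its Borel sets. -/
abbrev Pt (d : ℕ) : Type := EuclideanSpace ℝ (Fin d)

/-- The unit cube `[0,1]^d`. -/
def unitCube (d : ℕ) : Set (Pt d) := {x | ∀ i, x i ∈ Set.Icc (0 : ℝ) 1}

/-- A probability distribution of `(X, Y)` on `ℝ^d × {0,1}`, given as the couple of the marginal
distribution of `X` and the regression function `η(x) = P(Y = 1 | X = x)`.
The label `1` is `true` and the label `0` is `false`. -/
structure LabelledDist (d : ℕ) where
  /-- the marginal distribution of `X` -/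
  marginal : Measure (Pt d)
  /-- the regression function -/
  eta : Pt d → ℝ
  isProbabilityMeasure_marginal : IsProbabilityMeasure marginal
  measurable_eta : Measurable eta
  eta_mem : ∀ x, eta x ∈ Set.Icc (0 : ℝ) 1

namespace LabelledDist

variable {d : ℕ}

instance (P : LabelledDist d) : IsProbabilityMeasure P.marginal :=
  P.isProbabilityMeasure_marginal

/-- The joint law of `(X, Y)`: `X` follows the marginal and, given `X = x`, `Y` is Bernoulli with
parameter `η(x)`. -/
noncomputable def law (P : LabelledDist d) : Measure (Pt d × Bool) :=
  (P.marginal.withDensity fun x => ENNReal.ofReal (P.eta x)).map (fun x => (x, true)) +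
    (P.marginal.withDensity fun x => ENNReal.ofReal (1 - P.eta x)).map (fun x => (x, false))

theorem law_apply_true (P : LabelledDist d) {s : Set (Pt d)} (hs : MeasurableSet s) :
    P.law (s ×ˢ {true}) = ∫⁻ x in s, ENNReal.ofReal (P.eta x) ∂P.marginal := by
  have hm : MeasurableSet (s ×ˢ ({true} : Set Bool)) := hs.prod (measurableSet_singleton _)
  rw [law, Measure.add_apply, Measure.map_apply (by fun_prop) hm,
    Measure.map_apply (by fun_prop) hm]
  have h1 : (fun x : Pt d => (x, true)) ⁻¹' (s ×ˢ {true}) = s := by ext; simp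
  have h2 : (fun x : Pt d => (x, false)) ⁻¹' (s ×ˢ {true}) = ∅ := by ext; simp
  rw [h1, h2, measure_empty, add_zero, withDensity_apply _ hs]

/-- The first marginal of the joint law is the prescribed one. -/
theorem map_fst_law (P : LabelledDist d) : P.law.map Prod.fst = P.marginal := by
  ext s hs
  have hm : MeasurableSet (Prod.fst ⁻¹' s : Set (Pt d × Bool)) := measurable_fst hs
  rw [Measure.map_apply measurable_fst hs, law, Measure.add_apply,
    Measure.map_apply (by fun_prop) hm, Measure.map_apply (by fun_prop) hm]
  have h1 : (fun x : Pt d => (x, true)) ⁻¹' (Prod.fst ⁻¹' s) = s := by ext; simp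
  have h2 : (fun x : Pt d => (x, false)) ⁻¹' (Prod.fst ⁻¹' s) = s := by ext; simp
  rw [h1, h2, withDensity_apply _ hs, withDensity_apply _ hs,
    ← lintegral_add_left (P.measurable_eta.ennreal_ofReal)]
  have h3 : ∀ x, ENNReal.ofReal (P.eta x) + ENNReal.ofReal (1 - P.eta x) = 1 := by
    intro x
    rw [← ENNReal.ofReal_add (P.eta_mem x).1 (by linarith [(P.eta_mem x).2])]
    simp
  simp [h3]

instance (P : LabelledDist d) : IsProbabilityMeasure P.law := by
  have h := map_fst_law P
  refine ⟨?_⟩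
  rw [← Set.preimage_univ (f := Prod.fst), ← Measure.map_apply measurable_fst MeasurableSet.univ, h]
  exact measure_univ

/-- The classification error `R(f) = P(f(X) ≠ Y)`. -/
noncomputable def risk (P : LabelledDist d) (f : Pt d → Bool) : ℝ :=
  P.law.real {z | f z.1 ≠ z.2}

open Classical in
/-- The Bayes classifier `f*(x) = 1` if `η(x) ≥ 1/2`, and `0` otherwise. -/
noncomputable def bayes (P : LabelledDist d) : Pt d → Bool :=
  fun x => decide (1 / 2 ≤ P.eta x)

/-- The excess risk `R(f) - R(f*)`. -/
noncomputable def excessRisk (P : LabelledDist d) (f : Pt d → Bool) : ℝ :=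
  P.risk f - P.risk P.bayes

/-- `(α, L)`-smoothness of the regression function with respect to the marginal distribution. -/
def IsSmooth (P : LabelledDist d) (α L : ℝ) : Prop :=
  ∀ x ∈ P.marginal.support, ∀ x' ∈ P.marginal.support,
    |P.eta x - P.eta x'| ≤ L * P.marginal.real (Metric.ball x (dist x x')) ^ (α / d)

/-- Tsybakov's margin noise assumption with parameters `(β, C)`. -/
def IsTsybakov (P : LabelledDist d) (β C : ℝ) : Prop :=
  ∀ ε : ℝ, 0 < ε → ε ≤ 1 →
    P.marginal.real {x | |P.eta x - 1 / 2| < ε} < C * ε ^ β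

end LabelledDist

/-- The class `𝒫(α, β)` (with constants `L` and `C`) of the distributions that are supported in the
unit cube and satisfy both the smoothness and the margin noise assumption. -/
def distClass (d : ℕ) (α β L C : ℝ) : Set (LabelledDist d) :=
  {P | P.marginal.support ⊆ unitCube d ∧ P.IsSmooth α L ∧ P.IsTsybakov β C}

/-- A pool-based active learning strategy over a pool of `w` points, possibly randomized through
a seed in `Ξ`. All decisions depend on the seed, on the unlabelled pool `X_1, …, X_w` and on the
history, that is, the list of the pairs (index in the pool, revealed label) requested so far,
the most recent one first. -/
structure ActiveLearner (Ξ : Type*) [MeasurableSpace Ξ] (d w : ℕ) where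
  /-- the index of the next point whose label is requested; `none` means to stop requesting -/
  request : Ξ → (Fin w → Pt d) → List (Fin w × Bool) → Option (Fin w)
  /-- the classifier that is returned after the last request -/
  classify : Ξ → (Fin w → Pt d) → List (Fin w × Bool) → Pt d → Bool
  measurableSet_request : ∀ (h : List (Fin w × Bool)) (i : Fin w),
    MeasurableSet {p : Ξ × (Fin w → Pt d) | request p.1 p.2 h = some i}
  measurable_classify : ∀ h : List (Fin w × Bool),
    Measurable fun p : Ξ × (Fin w → Pt d) × Pt d => classify p.1 p.2.1 h p.2.2

namespace ActiveLearner

variable {Ξ : Type*} [MeasurableSpace Ξ] {d w : ℕ}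

/-- The history after at most `k` label requests, for the seed `u`, on the labelled sample `S`
of which only the requested labels are read. -/
def history (A : ActiveLearner Ξ d w) (u : Ξ) (S : Fin w → Pt d × Bool) :
    ℕ → List (Fin w × Bool)
  | 0 => []
  | k + 1 =>
    match A.request u (fun i => (S i).1) (A.history u S k) with
    | none => A.history u S k
    | some i => (i, (S i).2) :: A.history u S k

/-- The classifier obtained with a budget of `n` label requests. -/
def output (A : ActiveLearner Ξ d w) (n : ℕ) (u : Ξ) (S : Fin w → Pt d × Bool) : Pt d → Bool :=
  A.classify u (fun i => (S i).1) (A.history u S n)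

/-- The expected excess risk of the classifier obtained with at most `n` label requests, when the
sample is i.i.d. from `P` and the independent seed has distribution `ν`. -/
noncomputable def expectedExcessRisk (A : ActiveLearner Ξ d w) (ν : Measure Ξ) (n : ℕ)
    (P : LabelledDist d) : ENNReal :=
  ∫⁻ z : Ξ × (Fin w → Pt d × Bool), ENNReal.ofReal (P.excessRisk (A.output n z.1 z.2))
    ∂(ν.prod (Measure.pi fun _ : Fin w => P.law))

end ActiveLearner

/-!
The proof is Assouad's method, with hypotheses that live on a one-dimensional segment.

*Hypotheses.* The marginal is the uniform distribution on a coordinate segment of the cube, so that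
the ball around one point of the segment with a second one on its boundary has mass at least their
distance (`le_segmentMeasure_ball`). With `a = α / d`, the smoothness condition then follows from
`a`-Hölder continuity in one variable, and the dimension enters through `a` only. For a set of `m`
crossings `h, 2h, …, mh` the regression function is `1 / 2 ± κ D ^ a`, capped to `[0, 1]`, where `D` is
the distance to the crossings and `κ = L 2 ^ (a - 1)`. Its sign is `σ j` on the `j`-th cell
`[jh, (j + 1)h)` and positive beyond the cells. A change of sign takes place at a crossing, and the
concavity of `u ↦ u ^ a` gives the Hölder constant `L` across it (`abs_profile_sub_profile_le`).
The margin condition asks for the length of the neighbourhood of radius `r` of the crossings, which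
is at most `((m - 1) h ^ (1 - b) + 1) (2r) ^ b` with `b = a β ≤ 1`; as `ε = κ r ^ a` means
`(2ε) ^ β = L ^ β (2r) ^ b` and as `L > 1`, there is room for about `h ^ (b - 1)` cells, and for at
least one even if `b = 1` (`volume_amplitude_lt`).

*Information.* For a fixed seed and a fixed pool, an active learner is a decision tree of depth `n`.
If two hypotheses differ by the sign of one cell only, then a request outside of the cell preserves
the affinity `∑ √(A B)` of the laws of the history, and a request in it lowers the affinity by at most
`2 τ² (A + B)`, with `τ = κ h ^ a` (`sqrt_affinity_step`). All cells together receive at most `n`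
requests. Hence, if `16 τ² n ≤ m`, the sign of a given point in each cell is missed, on average over
`σ`, in at least `m / 8` of the cells (`sum_sum_labels_ge`). This passes to random pools since all
hypotheses share the marginal and the labels are independent given the pool (`lintegral_pi_law`).

*Rate.* A missed sign costs about `h ^ (a + 1)` of excess risk per cell, thus about `h ^ (a + b)`
altogether. The budget allows `h` of order `n ^ (-1 / (2a + 1 - b))` (`exists_scale`).
-/

/-! ### Decision trees over a finite pool -/

/-- The probability of the label `b` under the Bernoulli law with parameter `p`. -/
def labelProb (p : ℝ) (b : Bool) : ℝ := if b then p else 1 - p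

theorem labelProb_nonneg {p : ℝ} (hp : p ∈ Set.Icc (0 : ℝ) 1) (b : Bool) : 0 ≤ labelProb p b := by
  cases b <;> simp [labelProb, hp.1, hp.2]

section Tree

variable {w : ℕ}

/-- One label request: if the strategy `q` asks for the index `i`, then the history is extended by
the label `y i`. -/
def queryStep (q : List (Fin w × Bool) → Option (Fin w)) (y : Fin w → Bool)
    (h : List (Fin w × Bool)) : List (Fin w × Bool) :=
  match q h with
  | none => h
  | some i => (i, y i) :: h

/-- The probability that independent Bernoulli labels with parameters `θ i` agree with all the
entries of the history `h`. -/
def historyProb (θ : Fin w → ℝ) (h : List (Fin w × Bool)) : ℝ :=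
  ∏ i, ∑ b, if ∀ e ∈ h, e.1 = i → e.2 = b then labelProb (θ i) b else 0

theorem historyProb_nil (θ : Fin w → ℝ) : historyProb θ [] = 1 := by
  simp [historyProb, labelProb]

theorem historyProb_nonneg {θ : Fin w → ℝ} (hθ : ∀ i, θ i ∈ Set.Icc (0 : ℝ) 1)
    (h : List (Fin w × Bool)) : 0 ≤ historyProb θ h := by
  refine Finset.prod_nonneg fun i _ => Finset.sum_nonneg fun b _ => ?_
  split_ifs
  · exact labelProb_nonneg (hθ i) b
  · exact le_rfl

theorem sum_labels_agree (θ : Fin w → ℝ) (h : List (Fin w × Bool)) :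
    ∑ y : Fin w → Bool, (if ∀ e ∈ h, y e.1 = e.2 then ∏ i, labelProb (θ i) (y i) else 0) =
      historyProb θ h := by
  rw [historyProb, Finset.prod_univ_sum, Fintype.piFinset_univ]
  refine Finset.sum_congr rfl fun y _ => ?_
  split_ifs with hy
  · refine Finset.prod_congr rfl fun i _ => ?_
    rw [if_pos]
    rintro e he rfl
    exact (hy e he).symm
  · push Not at hy
    obtain ⟨e, he, hne⟩ := hy
    symm
    refine Finset.prod_eq_zero (Finset.mem_univ e.1) ?_
    rw [if_neg]
    intro H
    exact hne (H e he rfl).symm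

/-- A repeated request of the same index gives no information. -/
theorem historyProb_cons_of_mem (θ : Fin w → ℝ) {h : List (Fin w × Bool)} {i : Fin w} {b : Bool}
    (hm : (i, b) ∈ h) : historyProb θ ((i, b) :: h) = historyProb θ h := by
  unfold historyProb
  refine Finset.prod_congr rfl fun k _ => Finset.sum_congr rfl fun c _ => ?_
  refine if_congr ?_ rfl rfl
  simp only [List.mem_cons, forall_eq_or_imp, and_iff_right_iff_imp]
  intro H
  exact H _ hm

theorem historyProb_cons_of_fresh (θ : Fin w → ℝ) {h : List (Fin w × Bool)} {i : Fin w}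
    (hi : ∀ e ∈ h, e.1 ≠ i) (b : Bool) :
    historyProb θ ((i, b) :: h) = labelProb (θ i) b * historyProb θ h := by
  unfold historyProb
  rw [← Finset.mul_prod_erase _ _ (Finset.mem_univ i), ← Finset.mul_prod_erase _ _
    (Finset.mem_univ i), ← mul_assoc]
  congr 1
  · have h1 : ∀ c : Bool, (∀ e ∈ (i, b) :: h, e.1 = i → e.2 = c) ↔ b = c := by
      intro c
      simp only [List.mem_cons, forall_eq_or_imp, forall_const]
      exact ⟨fun H => H.1, fun H => ⟨H, fun e he h' => absurd h' (hi e he)⟩⟩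
    have h2 : ∀ c : Bool, (∀ e ∈ h, e.1 = i → e.2 = c) ↔ True := by
      intro c
      exact ⟨fun _ => trivial, fun _ e he h' => absurd h' (hi e he)⟩
    simp only [h1, h2, if_true]
    cases b <;> simp [labelProb]
  · refine Finset.prod_congr rfl fun k hk => Finset.sum_congr rfl fun c _ => ?_
    refine if_congr ?_ rfl rfl
    simp only [List.mem_cons, forall_eq_or_imp, and_iff_right_iff_imp]
    intro _ h'
    exact absurd h'.symm (Finset.ne_of_mem_erase hk)

theorem historyProb_cons_add (θ : Fin w → ℝ) (h : List (Fin w × Bool)) (i : Fin w) :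
    historyProb θ ((i, true) :: h) + historyProb θ ((i, false) :: h) = historyProb θ h := by
  simp only [← sum_labels_agree, ← Finset.sum_add_distrib]
  refine Finset.sum_congr rfl fun y _ => ?_
  cases hy : y i <;> simp [hy]

/-- The expectation of the functional `G` of the history after `k` further requests, started at `h`:
the sum over the leaves `l` of the decision tree of `N l * G l`. -/
def treeSum (q : List (Fin w × Bool) → Option (Fin w)) (N G : List (Fin w × Bool) → ℝ) :
    ℕ → List (Fin w × Bool) → ℝ
  | 0, h => N h * G h
  | k + 1, h =>
    match q h with
    | none => treeSum q N G k h
    | some i => treeSum q N G k ((i, true) :: h) + treeSum q N G k ((i, false) :: h)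

/-- The sum over the labels of the whole pool, all of which but the requested ones are summed out, is
the sum over the decision tree. -/
theorem sum_labels_eq_treeSum (q : List (Fin w × Bool) → Option (Fin w)) (θ : Fin w → ℝ)
    (G : List (Fin w × Bool) → ℝ) (k : ℕ) (h : List (Fin w × Bool)) :
    ∑ y : Fin w → Bool, (if ∀ e ∈ h, y e.1 = e.2 then
        (∏ i, labelProb (θ i) (y i)) * G ((queryStep q y)^[k] h) else 0) =
      treeSum q (historyProb θ) G k h := by
  induction k generalizing h with
  | zero =>
    simp only [Function.iterate_zero, id, treeSum, ← sum_labels_agree, Finset.sum_mul, ite_mul,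
      zero_mul]
  | succ k ih =>
    rw [treeSum]
    cases hq : q h with
    | none =>
      rw [← ih]
      simp only [Function.iterate_succ_apply, queryStep, hq]
    | some i =>
      simp only [← ih, ← Finset.sum_add_distrib]
      refine Finset.sum_congr rfl fun y _ => ?_
      have : queryStep q y h = (i, y i) :: h := by simp [queryStep, hq]
      rw [Function.iterate_succ_apply, this]
      cases hy : y i <;> simp [hy]

/-- The expected number of requests with index in `s` among `k` further requests, started at `h`,
weighted with the probabilities `N` of the histories. -/
def treeCount (q : List (Fin w × Bool) → Option (Fin w)) (N : List (Fin w × Bool) → ℝ)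
    (s : Fin w → Prop) [DecidablePred s] : ℕ → List (Fin w × Bool) → ℝ
  | 0, _ => 0
  | k + 1, h =>
    match q h with
    | none => treeCount q N s k h
    | some i => (if s i then N h else 0) + (treeCount q N s k ((i, true) :: h) +
        treeCount q N s k ((i, false) :: h))

/-- Each request falls into at most one of the disjoint cells `s j`, so that the expected numbers of
requests in the cells add up to at most the budget. -/
theorem sum_treeCount_le {J : Type*} [Fintype J] (q : List (Fin w × Bool) → Option (Fin w))
    {θ : Fin w → ℝ} (hθ : ∀ i, θ i ∈ Set.Icc (0 : ℝ) 1) (s : J → Fin w → Prop)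
    [∀ j, DecidablePred (s j)] (hs : ∀ i j j', s j i → s j' i → j = j') (k : ℕ)
    (h : List (Fin w × Bool)) :
    ∑ j, treeCount q (historyProb θ) (s j) k h ≤ k * historyProb θ h := by
  induction k generalizing h with
  | zero => simp [treeCount]
  | succ k ih =>
    have h0 := historyProb_nonneg hθ h
    push_cast
    cases hq : q h with
    | none =>
      simp only [treeCount, hq]
      linarith [ih h]
    | some i =>
      simp only [treeCount, hq, Finset.sum_add_distrib]
      have h1 : ∑ j, (if s j i then historyProb θ h else 0) ≤ historyProb θ h := by
        by_cases hj : ∃ j, s j i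
        · obtain ⟨j, hj⟩ := hj
          rw [Finset.sum_eq_single j]
          · rw [if_pos hj]
          · intro j' _ hne
            exact if_neg fun h' => hne (hs i _ _ h' hj)
          · simp
        · push Not at hj
          simpa [hj] using h0
      have h2 := historyProb_cons_add θ h i
      have h3 := ih ((i, true) :: h)
      have h4 := ih ((i, false) :: h)
      have : (k : ℝ) * historyProb θ h = k * historyProb θ ((i, true) :: h) +
        k * historyProb θ ((i, false) :: h) := by rw [← h2]; ring
      linarith

/-! ### Testing the sign of one cell -/

/-- A test between two weights `A` and `B` errs at least with the smaller one. -/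
theorem sqrt_mul_sub_le_min {A B : ℝ} (hA : 0 ≤ A) (hB : 0 ≤ B) :
    √(A * B) - (A + B) / 4 ≤ min A B := by
  have key : ∀ x y : ℝ, 0 ≤ x → 0 ≤ y → √(x * y) - (x + y) / 4 ≤ x := by
    intro x y hx hy
    have : √(x * y) ≤ x + y / 4 := by
      rw [Real.sqrt_le_left (by positivity)]
      nlinarith [sq_nonneg (x - y / 4)]
    linarith
  refine le_min (key A B hA hB) ?_
  have := key B A hB hA
  rwa [mul_comm, add_comm B A] at this

/-- A label with parameter `p` under the one hypothesis and `1 - p` under the other one multiplies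
the affinity by `2 √(p (1 - p)) = √(1 - 4 (p - 1 / 2)²) ≥ 1 - 4 τ²`. -/
theorem sqrt_affinity_query {A B p τ : ℝ} (hA : 0 ≤ A) (hB : 0 ≤ B)
    (hp : p ∈ Set.Icc (0 : ℝ) 1) (hτ : |p - 1 / 2| ≤ τ) :
    √(A * B) - 2 * τ ^ 2 * (A + B) ≤
      √((p * A) * ((1 - p) * B)) + √(((1 - p) * A) * (p * B)) := by
  have hp' : 0 ≤ p * (1 - p) := mul_nonneg hp.1 (by linarith [hp.2])
  have e1 : (p * A) * ((1 - p) * B) = (p * (1 - p)) * (A * B) := by ring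
  have e2 : ((1 - p) * A) * (p * B) = (p * (1 - p)) * (A * B) := by ring
  rw [e1, e2, Real.sqrt_mul hp']
  have hs : √(A * B) ≤ (A + B) / 2 := by
    rw [Real.sqrt_le_left (by positivity)]
    nlinarith [sq_nonneg (A - B)]
  have hsq : (p - 1 / 2) ^ 2 ≤ τ ^ 2 := by
    rw [← sq_abs (p - 1 / 2)]
    exact pow_le_pow_left₀ (abs_nonneg _) hτ 2
  have hr : 1 - 4 * (p - 1 / 2) ^ 2 ≤ 2 * √(p * (1 - p)) := by
    have : 2 * (p * (1 - p)) ≤ √(p * (1 - p)) := by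
      apply Real.le_sqrt_of_sq_le
      nlinarith [sq_nonneg (p - 1 / 2)]
    nlinarith
  have h0 := Real.sqrt_nonneg (A * B)
  have h1 : (1 - 4 * τ ^ 2) * √(A * B) ≤ 2 * √(p * (1 - p)) * √(A * B) := by
    apply mul_le_mul_of_nonneg_right _ h0
    linarith
  nlinarith [mul_le_mul_of_nonneg_left hs (by positivity : 0 ≤ 4 * τ ^ 2)]

/-- The affinity `√(A B)` of the two history probabilities is preserved by a request outside of `s`
and loses at most `2 τ² (A + B)` at a request in `s`, where the two parameters are symmetric about
`1 / 2` and `τ`-close to it. -/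
theorem sqrt_affinity_step {θ θ' : Fin w → ℝ} {τ : ℝ} (hθ : ∀ i, θ i ∈ Set.Icc (0 : ℝ) 1)
    (hθ' : ∀ i, θ' i ∈ Set.Icc (0 : ℝ) 1) (s : Fin w → Prop) [DecidablePred s]
    (hout : ∀ i, ¬ s i → θ' i = θ i) (hin : ∀ i, s i → θ' i = 1 - θ i)
    (hτ : ∀ i, s i → |θ i - 1 / 2| ≤ τ) (h : List (Fin w × Bool)) (i : Fin w) :
    √(historyProb θ h * historyProb θ' h) -
        2 * τ ^ 2 * (if s i then historyProb θ h + historyProb θ' h else 0) ≤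
      √(historyProb θ ((i, true) :: h) * historyProb θ' ((i, true) :: h)) +
        √(historyProb θ ((i, false) :: h) * historyProb θ' ((i, false) :: h)) := by
  have hA := historyProb_nonneg hθ h
  have hB := historyProb_nonneg hθ' h
  have hpos : 0 ≤ 2 * τ ^ 2 * (if s i then historyProb θ h + historyProb θ' h else 0) := by
    split_ifs <;> positivity
  by_cases hf : ∀ e ∈ h, e.1 ≠ i
  · simp only [historyProb_cons_of_fresh _ hf]
    by_cases hsi : s i
    · have := sqrt_affinity_query hA hB (hθ i) (hτ i hsi)
      simpa [hsi, hin i hsi, labelProb] using this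
    · have hp := hθ i
      have e : ∀ c : ℝ, 0 ≤ c → √(c * historyProb θ h * (c * historyProb θ' h)) =
          c * √(historyProb θ h * historyProb θ' h) := by
        intro c hc
        rw [show c * historyProb θ h * (c * historyProb θ' h) =
          c ^ 2 * (historyProb θ h * historyProb θ' h) by ring, Real.sqrt_mul (by positivity),
          Real.sqrt_sq hc]
      rw [hout i hsi, e _ (labelProb_nonneg hp _), e _ (labelProb_nonneg hp _)]
      simp only [hsi, if_false, labelProb, if_true, Bool.false_eq_true]
      linarith
  -- The label of an index that occurs in the history is already determined.
  · push Not at hf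
    obtain ⟨⟨i', b⟩, he, rfl⟩ := hf
    have h1 := historyProb_cons_of_mem θ he
    have h2 := historyProb_cons_of_mem θ' he
    cases b <;> simp only [h1, h2]
    · linarith [Real.sqrt_nonneg (historyProb θ ((i', true) :: h) *
        historyProb θ' ((i', true) :: h))]
    · linarith [Real.sqrt_nonneg (historyProb θ ((i', false) :: h) *
        historyProb θ' ((i', false) :: h))]

/-- The two error probabilities of a test after `k` requests add up to at least a constant, less
`2 τ²` times the expected numbers of requests in `s`. -/
theorem treeSum_add_treeSum_ge {θ θ' : Fin w → ℝ} {τ : ℝ} (hθ : ∀ i, θ i ∈ Set.Icc (0 : ℝ) 1)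
    (hθ' : ∀ i, θ' i ∈ Set.Icc (0 : ℝ) 1) (s : Fin w → Prop) [DecidablePred s]
    (hout : ∀ i, ¬ s i → θ' i = θ i) (hin : ∀ i, s i → θ' i = 1 - θ i)
    (hτ : ∀ i, s i → |θ i - 1 / 2| ≤ τ) (q : List (Fin w × Bool) → Option (Fin w))
    {G G' : List (Fin w × Bool) → ℝ} (hG : ∀ h, 0 ≤ G h) (hG' : ∀ h, 0 ≤ G' h)
    (hGG : ∀ h, G h + G' h = 1) (k : ℕ) (h : List (Fin w × Bool)) :
    √(historyProb θ h * historyProb θ' h) - (historyProb θ h + historyProb θ' h) / 4 -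
        2 * τ ^ 2 * (treeCount q (historyProb θ) s k h + treeCount q (historyProb θ') s k h) ≤
      treeSum q (historyProb θ) G k h + treeSum q (historyProb θ') G' k h := by
  induction k generalizing h with
  | zero =>
    simp only [treeCount, treeSum]
    have hA := historyProb_nonneg hθ h
    have hB := historyProb_nonneg hθ' h
    have h1 := sqrt_mul_sub_le_min hA hB
    have h2 := mul_le_mul_of_nonneg_right (min_le_left (historyProb θ h) (historyProb θ' h)) (hG h)
    have h3 := mul_le_mul_of_nonneg_right (min_le_right (historyProb θ h) (historyProb θ' h))
      (hG' h)
    have h4 : min (historyProb θ h) (historyProb θ' h) * G h +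
      min (historyProb θ h) (historyProb θ' h) * G' h = min (historyProb θ h) (historyProb θ' h) := by
      rw [← mul_add, hGG, mul_one]
    linarith
  | succ k ih =>
    cases hq : q h with
    | none =>
      simp only [treeCount, treeSum, hq]
      exact ih h
    | some i =>
      simp only [treeCount, treeSum, hq]
      have h1 := sqrt_affinity_step hθ hθ' s hout hin hτ h i
      have h2 := ih ((i, true) :: h)
      have h3 := ih ((i, false) :: h)
      have h4 := historyProb_cons_add θ h i
      have h5 := historyProb_cons_add θ' h i
      have h6 : (if s i then historyProb θ h + historyProb θ' h else 0) =
        (if s i then historyProb θ h else 0) + (if s i then historyProb θ' h else 0) := by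
        split_ifs <;> simp
      rw [h6] at h1
      linarith

/-- Assouad's lemma for adaptive label requests. The sign `σ j` is carried by the labels of the pool
points in the `j`-th cell `s j`; `G j b` is the indicator of the event that `b` is not the guess for
`σ j`. -/
theorem sum_sum_labels_ge {m : ℕ} (n : ℕ) (θ : (Fin m → Bool) → Fin w → ℝ) {τ : ℝ}
    (hθ : ∀ σ i, θ σ i ∈ Set.Icc (0 : ℝ) 1) (s : Fin m → Fin w → Prop)
    (hs : ∀ i j j', s j i → s j' i → j = j')
    (hout : ∀ σ j i, ¬ s j i → θ (Function.update σ j (!σ j)) i = θ σ i)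
    (hin : ∀ σ j i, s j i → θ (Function.update σ j (!σ j)) i = 1 - θ σ i)
    (hτ : ∀ σ j i, s j i → |θ σ i - 1 / 2| ≤ τ) (hn : 16 * τ ^ 2 * n ≤ m)
    (q : List (Fin w × Bool) → Option (Fin w)) (G : Fin m → Bool → List (Fin w × Bool) → ℝ)
    (hG : ∀ j b h, 0 ≤ G j b h) (hGG : ∀ j b h, G j b h + G j (!b) h = 1) :
    (2 : ℝ) ^ m * (m / 8) ≤ ∑ σ : Fin m → Bool, ∑ j, ∑ y : Fin w → Bool,
      (∏ i, labelProb (θ σ i) (y i)) * G j (σ j) ((queryStep q y)^[n] []) := by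
  classical
  have e : ∀ σ j, ∑ y : Fin w → Bool,
      (∏ i, labelProb (θ σ i) (y i)) * G j (σ j) ((queryStep q y)^[n] []) =
      treeSum q (historyProb (θ σ)) (G j (σ j)) n [] := by
    intro σ j
    rw [← sum_labels_eq_treeSum]
    simp
  simp only [e]
  -- Averages over all signs do not change when the sign of one cell is flipped.
  have flip : ∀ (j : Fin m) (F : (Fin m → Bool) → ℝ),
      ∑ σ, F (Function.update σ j (!σ j)) = ∑ σ, F σ := by
    intro j F
    have hinv : Function.Involutive fun σ : Fin m → Bool => Function.update σ j (!σ j) := by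
      intro σ
      simp
    exact Equiv.sum_comp hinv.toPerm F
  have hpair : ∀ j σ, 1 / 2 - 2 * τ ^ 2 * (treeCount q (historyProb (θ σ)) (s j) n [] +
      treeCount q (historyProb (θ (Function.update σ j (!σ j)))) (s j) n []) ≤
      treeSum q (historyProb (θ σ)) (G j (σ j)) n [] +
      treeSum q (historyProb (θ (Function.update σ j (!σ j))))
        (G j (Function.update σ j (!σ j) j)) n [] := by
    intro j σ
    have := treeSum_add_treeSum_ge (hθ σ) (hθ (Function.update σ j (!σ j))) (s j) (hout σ j)
      (hin σ j) (hτ σ j) q (hG j (σ j)) (hG j (!σ j)) (hGG j (σ j)) n []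
    simp only [historyProb_nil] at this
    rw [Function.update_self]
    norm_num at this ⊢
    linarith
  have hcell : ∀ j, ∑ σ : Fin m → Bool, (1 / 4 - 2 * τ ^ 2 *
      treeCount q (historyProb (θ σ)) (s j) n []) ≤
      ∑ σ, treeSum q (historyProb (θ σ)) (G j (σ j)) n [] := by
    intro j
    have h1 := Finset.sum_le_sum fun σ (_ : σ ∈ Finset.univ) => hpair j σ
    rw [Finset.sum_add_distrib,
      flip j (fun σ => treeSum q (historyProb (θ σ)) (G j (σ j)) n [])] at h1
    simp only [mul_add, Finset.sum_sub_distrib, Finset.sum_add_distrib] at h1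
    rw [flip j (fun σ => 2 * τ ^ 2 * treeCount q (historyProb (θ σ)) (s j) n [])] at h1
    simp only [Finset.sum_sub_distrib]
    simp only [Finset.sum_const, nsmul_eq_mul] at h1 ⊢
    linarith
  rw [Finset.sum_comm]
  refine le_trans ?_ (Finset.sum_le_sum fun j _ => hcell j)
  rw [Finset.sum_comm]
  have hσ : ∀ σ : Fin m → Bool, (m / 8 : ℝ) ≤ ∑ j, (1 / 4 - 2 * τ ^ 2 *
      treeCount q (historyProb (θ σ)) (s j) n []) := by
    intro σ
    have := sum_treeCount_le q (hθ σ) s hs n []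
    rw [historyProb_nil, mul_one] at this
    rw [Finset.sum_sub_distrib, ← Finset.mul_sum]
    simp only [Finset.sum_const, Finset.card_univ, Fintype.card_fin, nsmul_eq_mul]
    nlinarith [mul_le_mul_of_nonneg_left this (by positivity : 0 ≤ 2 * τ ^ 2)]
  calc (2 : ℝ) ^ m * (m / 8) = ∑ σ : Fin m → Bool, (m / 8 : ℝ) := by simp
    _ ≤ _ := Finset.sum_le_sum fun σ _ => hσ σ

end Tree

/-! ### The law of a labelled sample -/

namespace LabelledDist

variable {d : ℕ}

theorem labelProb_eta_nonneg (P : LabelledDist d) (x : Pt d) (b : Bool) :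
    0 ≤ labelProb (P.eta x) b :=
  labelProb_nonneg (P.eta_mem x) b

theorem measurable_labelProb_eta (P : LabelledDist d) (b : Bool) :
    Measurable fun x => labelProb (P.eta x) b := by
  have := P.measurable_eta
  cases b
  · simpa [labelProb] using this.const_sub 1
  · simpa [labelProb] using this

theorem law_apply_eq_sum (P : LabelledDist d) {s : Set (Pt d × Bool)} (hs : MeasurableSet s) :
    P.law s = ∑ b, ∫⁻ x, ENNReal.ofReal (labelProb (P.eta x) b) *
      ((fun x => (x, b)) ⁻¹' s).indicator 1 x ∂P.marginal := by
  have key : ∀ b : Bool, ∫⁻ x, ENNReal.ofReal (labelProb (P.eta x) b) *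
      ((fun x => (x, b)) ⁻¹' s).indicator 1 x ∂P.marginal =
      ((P.marginal.withDensity fun x => ENNReal.ofReal (labelProb (P.eta x) b)).map
        (fun x => (x, b))) s := by
    intro b
    have hm : MeasurableSet ((fun x : Pt d => (x, b)) ⁻¹' s) := measurable_prodMk_right hs
    rw [Measure.map_apply measurable_prodMk_right hs, withDensity_apply _ hm,
      ← lintegral_indicator hm]
    refine lintegral_congr fun x => ?_
    by_cases hx : x ∈ (fun x : Pt d => (x, b)) ⁻¹' s <;> simp [hx]
  rw [Finset.sum_congr rfl fun b _ => key b]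
  simp only [Fintype.sum_bool, labelProb, if_true, Bool.false_eq_true, if_false]
  rfl

/-- Sampling the pool first and the labels afterwards: given the pool, the labels are independent
Bernoulli variables. -/
theorem pi_law_eq_sum (P : LabelledDist d) (w : ℕ) :
    (Measure.pi fun _ : Fin w => P.law) = ∑ y : Fin w → Bool,
      ((Measure.pi fun _ : Fin w => P.marginal).withDensity fun X =>
        ∏ i, ENNReal.ofReal (labelProb (P.eta (X i)) (y i))).map fun X i => (X i, y i) := by
  have hmz : ∀ y : Fin w → Bool,
      Measurable (fun (X : Fin w → Pt d) (i : Fin w) => (X i, y i)) := by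
    intro y
    fun_prop
  refine Measure.pi_eq fun s hs => ?_
  have hbox : MeasurableSet (Set.univ.pi s) := MeasurableSet.univ_pi hs
  simp only [Measure.finsetSum_apply, law_apply_eq_sum P (hs _)]
  rw [Finset.prod_univ_sum, Fintype.piFinset_univ]
  refine Finset.sum_congr rfl fun y _ => ?_
  rw [Measure.map_apply (hmz y) hbox, withDensity_apply _ (hmz y hbox),
    ← lintegral_indicator (hmz y hbox)]
  have hmf : ∀ i, Measurable fun x : Pt d => ENNReal.ofReal (labelProb (P.eta x) (y i)) *
      ((fun x => (x, y i)) ⁻¹' s i).indicator 1 x := fun i =>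
    (P.measurable_labelProb_eta (y i)).ennreal_ofReal.mul
      (measurable_one.indicator (measurable_prodMk_right (hs i)))
  have hind := ProbabilityTheory.iIndepFun_pi (μ := fun _ : Fin w => P.marginal)
    (X := fun i x => ENNReal.ofReal (labelProb (P.eta x) (y i)) *
      ((fun x => (x, y i)) ⁻¹' s i).indicator 1 x) fun i => (hmf i).aemeasurable
  have hprod := ProbabilityTheory.lintegral_prod_eq_prod_lintegral_of_indepFun Finset.univ _ hind
    fun i => (hmf i).comp (measurable_pi_apply i)
  have hfac : ∀ i, ∫⁻ X : Fin w → Pt d, ENNReal.ofReal (labelProb (P.eta (X i)) (y i)) *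
      ((fun x => (x, y i)) ⁻¹' s i).indicator 1 (X i) ∂(Measure.pi fun _ : Fin w => P.marginal) =
      ∫⁻ x, ENNReal.ofReal (labelProb (P.eta x) (y i)) *
        ((fun x => (x, y i)) ⁻¹' s i).indicator 1 x ∂P.marginal := fun i =>
    (measurePreserving_eval (fun _ : Fin w => P.marginal) i).lintegral_comp (hmf i)
  simp only [hfac] at hprod
  rw [← hprod]
  refine lintegral_congr fun X => ?_
  rw [Finset.prod_mul_distrib]
  by_cases hX : ∀ i, (X i, y i) ∈ s i
  · have h1 : X ∈ (fun (X : Fin w → Pt d) (i : Fin w) => (X i, y i)) ⁻¹' Set.univ.pi s :=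
      fun i _ => hX i
    have h2 : ∏ i, ((fun x => (x, y i)) ⁻¹' s i).indicator (1 : Pt d → ENNReal) (X i) = 1 :=
      Finset.prod_eq_one fun i _ => by
        rw [Set.indicator_of_mem (show X i ∈ (fun x => (x, y i)) ⁻¹' s i from hX i)]
        rfl
    rw [Set.indicator_of_mem h1, h2, mul_one]
  · have h1 : X ∉ (fun (X : Fin w → Pt d) (i : Fin w) => (X i, y i)) ⁻¹' Set.univ.pi s :=
      fun h => hX fun i => h i (Set.mem_univ i)
    push Not at hX
    obtain ⟨i, hi⟩ := hX
    have h2 : ∏ i, ((fun x => (x, y i)) ⁻¹' s i).indicator (1 : Pt d → ENNReal) (X i) = 0 :=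
      Finset.prod_eq_zero (Finset.mem_univ i) (Set.indicator_of_notMem
        (show X i ∉ (fun x => (x, y i)) ⁻¹' s i from hi) _)
    rw [Set.indicator_of_notMem h1, h2, mul_zero]

theorem measurable_prod_labelProb (P : LabelledDist d) {w : ℕ} (y : Fin w → Bool) :
    Measurable fun X : Fin w → Pt d => ∏ i, ENNReal.ofReal (labelProb (P.eta (X i)) (y i)) :=
  Finset.measurable_prod _ fun i _ =>
    ((P.measurable_labelProb_eta (y i)).ennreal_ofReal).comp (measurable_pi_apply i)

theorem lintegral_pi_law (P : LabelledDist d) {w : ℕ} {F : (Fin w → Pt d × Bool) → ENNReal}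
    (hF : Measurable F) :
    ∫⁻ S, F S ∂(Measure.pi fun _ : Fin w => P.law) =
      ∫⁻ X, ∑ y : Fin w → Bool, (∏ i, ENNReal.ofReal (labelProb (P.eta (X i)) (y i))) *
        F (fun i => (X i, y i)) ∂(Measure.pi fun _ : Fin w => P.marginal) := by
  have hmz : ∀ y : Fin w → Bool,
      Measurable (fun (X : Fin w → Pt d) (i : Fin w) => (X i, y i)) := by
    intro y
    fun_prop
  rw [pi_law_eq_sum, lintegral_finsetSum_measure, lintegral_finsetSum]
  · refine Finset.sum_congr rfl fun y _ => ?_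
    rw [lintegral_map hF (hmz y)]
    exact lintegral_withDensity_eq_lintegral_mul _ (P.measurable_prod_labelProb y)
      (hF.comp (hmz y))
  · exact fun y _ => (P.measurable_prod_labelProb y).mul (hF.comp (hmz y))

/-! ### The excess risk -/

theorem risk_eq_integral (P : LabelledDist d) {f : Pt d → Bool} (hf : Measurable f) :
    P.risk f = ∫ x, labelProb (P.eta x) (!f x) ∂P.marginal := by
  have hs : MeasurableSet {z : Pt d × Bool | f z.1 ≠ z.2} :=
    (measurableSet_eq_fun (hf.comp measurable_fst) measurable_snd).compl
  have hm : Measurable fun x => labelProb (P.eta x) (!f x) := by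
    have : (fun x => labelProb (P.eta x) (!f x)) = fun x =>
        if f x = true then labelProb (P.eta x) false else labelProb (P.eta x) true := by
      ext x
      cases f x <;> simp
    rw [this]
    exact Measurable.ite (hf (measurableSet_singleton true)) (P.measurable_labelProb_eta _)
      (P.measurable_labelProb_eta _)
  rw [risk, Measure.real, law_apply_eq_sum P hs, integral_eq_lintegral_of_nonneg_ae
    (Filter.Eventually.of_forall fun x => P.labelProb_eta_nonneg x _) hm.aestronglyMeasurable,
    ← lintegral_finsetSum]
  · congr 1
    refine lintegral_congr fun x => ?_
    cases hx : f x <;> simp [hx, Set.indicator]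
  · exact fun b _ => (P.measurable_labelProb_eta b).ennreal_ofReal.mul
      (measurable_one.indicator (measurable_prodMk_right hs))

theorem measurable_bayes (P : LabelledDist d) : Measurable P.bayes := by
  refine measurable_to_bool ?_
  have : P.bayes ⁻¹' {true} = P.eta ⁻¹' Set.Ici (1 / 2) := by
    ext x
    simp [bayes]
  rw [this]
  exact P.measurable_eta measurableSet_Ici

open Classical in
/-- The excess risk is the integral of `|2η - 1|` over the region of disagreement with the Bayes
classifier. -/
theorem ofReal_excessRisk (P : LabelledDist d) {f : Pt d → Bool} (hf : Measurable f) :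
    ENNReal.ofReal (P.excessRisk f) =
      ∫⁻ x, (if f x ≠ P.bayes x then ENNReal.ofReal |2 * P.eta x - 1| else 0) ∂P.marginal := by
  have hint : ∀ g : Pt d → Bool, Measurable g →
      Integrable (fun x => labelProb (P.eta x) (!g x)) P.marginal := by
    intro g hg
    refine Integrable.of_bound (C := 1) ?_ ?_
    · have : (fun x => labelProb (P.eta x) (!g x)) = fun x =>
          if g x = true then labelProb (P.eta x) false else labelProb (P.eta x) true := by
        ext x
        cases g x <;> simp
      rw [this]
      exact (Measurable.ite (hg (measurableSet_singleton true)) (P.measurable_labelProb_eta _)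
        (P.measurable_labelProb_eta _)).aestronglyMeasurable
    · refine Filter.Eventually.of_forall fun x => ?_
      rw [Real.norm_of_nonneg (P.labelProb_eta_nonneg x _)]
      have := P.eta_mem x
      cases g x <;> simp [labelProb, this.1, this.2]
  have hpt : ∀ x, labelProb (P.eta x) (!f x) - labelProb (P.eta x) (!P.bayes x) =
      if f x ≠ P.bayes x then |2 * P.eta x - 1| else 0 := by
    intro x
    by_cases hx : 1 / 2 ≤ P.eta x
    · have h1 : P.bayes x = true := by simpa [bayes] using hx
      rw [h1, abs_of_nonneg (by linarith)]
      cases f x <;> simp [labelProb]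
      ring
    · have h1 : P.bayes x = false := by simpa [bayes] using hx
      rw [h1, abs_of_neg (by linarith)]
      cases f x <;> simp [labelProb]
      ring
  rw [excessRisk, P.risk_eq_integral hf, P.risk_eq_integral P.measurable_bayes,
    ← integral_sub (hint f hf) (hint _ P.measurable_bayes)]
  refine (ofReal_integral_eq_lintegral_ofReal
    ((hint f hf).sub (hint _ P.measurable_bayes)) ?_).trans ?_
  rotate_left
  · refine lintegral_congr fun x => ?_
    rw [Pi.sub_apply, hpt x]
    split_ifs <;> simp
  · refine Filter.Eventually.of_forall fun x => ?_
    rw [Pi.sub_apply, hpt x, Pi.zero_apply]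
    split_ifs <;> positivity

end LabelledDist

/-! ### Measurability of the output of an active learner -/

namespace ActiveLearner

variable {Ξ : Type*} [MeasurableSpace Ξ] {d w : ℕ}

theorem history_eq_iterate (A : ActiveLearner Ξ d w) (u : Ξ) (S : Fin w → Pt d × Bool) (k : ℕ) :
    A.history u S k =
      (queryStep (A.request u fun i => (S i).1) fun i => (S i).2)^[k] [] := by
  induction k with
  | zero => rfl
  | succ k ih =>
    rw [Function.iterate_succ_apply', ← ih]
    rfl

theorem measurableSet_request_eq (A : ActiveLearner Ξ d w) (h : List (Fin w × Bool))
    (o : Option (Fin w)) :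
    MeasurableSet {p : Ξ × (Fin w → Pt d) | A.request p.1 p.2 h = o} := by
  cases o with
  | some i => exact A.measurableSet_request h i
  | none =>
    have : {p : Ξ × (Fin w → Pt d) | A.request p.1 p.2 h = none} =
        (⋃ i, {p : Ξ × (Fin w → Pt d) | A.request p.1 p.2 h = some i})ᶜ := by
      ext p
      simp only [Set.mem_ofPred_eq, Set.mem_compl_iff, Set.mem_iUnion, not_exists]
      exact Option.eq_none_iff_forall_ne_some
    rw [this]
    exact (MeasurableSet.iUnion fun i => A.measurableSet_request h i).compl

theorem measurable_pool :
    Measurable fun z : Ξ × (Fin w → Pt d × Bool) => (z.1, fun i => (z.2 i).1) := by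
  fun_prop

theorem measurableSet_history_eq (A : ActiveLearner Ξ d w) (k : ℕ) (l : List (Fin w × Bool)) :
    MeasurableSet {z : Ξ × (Fin w → Pt d × Bool) | A.history z.1 z.2 k = l} := by
  induction k generalizing l with
  | zero => exact MeasurableSet.const ([] = l)
  | succ k ih =>
    have : {z : Ξ × (Fin w → Pt d × Bool) | A.history z.1 z.2 (k + 1) = l} =
        ⋃ (h : List (Fin w × Bool)) (o : Option (Fin w)), {z | A.history z.1 z.2 k = h} ∩
          ({z | A.request z.1 (fun i => (z.2 i).1) h = o} ∩
            {z | o.elim h (fun i => (i, (z.2 i).2) :: h) = l}) := by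
      ext z
      simp only [Set.mem_ofPred_eq, Set.mem_iUnion, Set.mem_inter_iff]
      have hstep : A.history z.1 z.2 (k + 1) =
          (A.request z.1 (fun i => (z.2 i).1) (A.history z.1 z.2 k)).elim
            (A.history z.1 z.2 k) (fun i => (i, (z.2 i).2) :: A.history z.1 z.2 k) := by
        rw [history]
        cases A.request z.1 (fun i => (z.2 i).1) (A.history z.1 z.2 k) <;> rfl
      constructor
      · intro hz
        exact ⟨_, _, rfl, rfl, hstep ▸ hz⟩
      · rintro ⟨h, o, rfl, rfl, hl⟩
        exact hstep.trans hl
    rw [this]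
    refine MeasurableSet.iUnion fun h => MeasurableSet.iUnion fun o => (ih h).inter
      ((measurable_pool (A.measurableSet_request_eq h o)).inter ?_)
    cases o with
    | none => exact MeasurableSet.const (h = l)
    | some i =>
      have hm : Measurable fun z : Ξ × (Fin w → Pt d × Bool) => (z.2 i).2 := by fun_prop
      exact hm (Set.toFinite {b | (i, b) :: h = l}).measurableSet

theorem measurable_output (A : ActiveLearner Ξ d w) (n : ℕ) :
    Measurable fun p : (Ξ × (Fin w → Pt d × Bool)) × Pt d => A.output n p.1.1 p.1.2 p.2 := by
  refine measurable_to_bool ?_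
  have : (fun p : (Ξ × (Fin w → Pt d × Bool)) × Pt d => A.output n p.1.1 p.1.2 p.2) ⁻¹' {true} =
      ⋃ h : List (Fin w × Bool), (Prod.fst ⁻¹' {z | A.history z.1 z.2 n = h}) ∩
        {p | A.classify p.1.1 (fun i => (p.1.2 i).1) h p.2 = true} := by
    ext p
    simp [output]
  rw [this]
  refine MeasurableSet.iUnion fun h =>
    (measurable_fst (A.measurableSet_history_eq n h)).inter ?_
  have hm : Measurable fun p : (Ξ × (Fin w → Pt d × Bool)) × Pt d =>
      (p.1.1, (fun i => (p.1.2 i).1), p.2) := by fun_prop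
  exact ((A.measurable_classify h).comp hm) (measurableSet_singleton true)

/-! ### Assouad's lemma for active learners -/

theorem lintegral_prod_pi_law (P : LabelledDist d) (ν : Measure Ξ) [IsProbabilityMeasure ν]
    {F : Ξ × (Fin w → Pt d × Bool) → ENNReal} (hF : Measurable F) :
    ∫⁻ z, F z ∂(ν.prod (Measure.pi fun _ : Fin w => P.law)) =
      ∫⁻ p : Ξ × (Fin w → Pt d), ∑ y : Fin w → Bool,
        (∏ i, ENNReal.ofReal (labelProb (P.eta (p.2 i)) (y i))) * F (p.1, fun i => (p.2 i, y i))
        ∂(ν.prod (Measure.pi fun _ : Fin w => P.marginal)) := by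
  rw [lintegral_prod _ hF.aemeasurable, lintegral_prod]
  · refine lintegral_congr fun u => ?_
    exact P.lintegral_pi_law (hF.comp measurable_prodMk_left)
  · refine (Finset.measurable_sum _ fun y _ => ?_).aemeasurable
    refine ((P.measurable_prod_labelProb y).comp measurable_snd).mul (hF.comp ?_)
    fun_prop

/-- If the labels in the cell `s j` carry the sign `σ j` with a noise level within `τ` of `1 / 2`,
and if the budget is too small to visit all cells often enough, then on average over `σ` an active
learner misses the sign of a constant proportion of the cells. -/
theorem sum_sum_lintegral_error_ge {m : ℕ} (n : ℕ) (A : ActiveLearner Ξ d w) (ν : Measure Ξ)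
    [IsProbabilityMeasure ν] (μ : Measure (Pt d)) (P : (Fin m → Bool) → LabelledDist d)
    (hμ : ∀ σ, (P σ).marginal = μ) {τ : ℝ} (s : Fin m → Set (Pt d))
    (hs : ∀ x j j', x ∈ s j → x ∈ s j' → j = j')
    (hout : ∀ σ j x, x ∉ s j → (P (Function.update σ j (!σ j))).eta x = (P σ).eta x)
    (hin : ∀ σ j x, x ∈ s j → (P (Function.update σ j (!σ j))).eta x = 1 - (P σ).eta x)
    (hτ : ∀ σ j x, x ∈ s j → |(P σ).eta x - 1 / 2| ≤ τ) (hn : 16 * τ ^ 2 * n ≤ m)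
    (x : Fin m → Pt d) :
    ENNReal.ofReal (2 ^ m * (m / 8)) ≤ ∑ σ, ∑ j,
      ∫⁻ z, (if A.output n z.1 z.2 (x j) ≠ σ j then 1 else 0)
        ∂(ν.prod (Measure.pi fun _ : Fin w => (P σ).law)) := by
  classical
  have hprob : IsProbabilityMeasure μ := hμ (fun _ => true) ▸ inferInstance
  have hF : ∀ (σ : Fin m → Bool) (j : Fin m), Measurable
      fun z : Ξ × (Fin w → Pt d × Bool) =>
        if A.output n z.1 z.2 (x j) ≠ σ j then (1 : ENNReal) else 0 := by
    intro σ j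
    have hm : Measurable fun z : Ξ × (Fin w → Pt d × Bool) => A.output n z.1 z.2 (x j) :=
      (A.measurable_output n).comp measurable_prodMk_right
    exact Measurable.ite (hm (measurableSet_singleton (σ j))).compl measurable_const
      measurable_const
  have hmeas : ∀ σ j, Measurable fun p : Ξ × (Fin w → Pt d) => ∑ y : Fin w → Bool,
      (∏ i, ENNReal.ofReal (labelProb ((P σ).eta (p.2 i)) (y i))) *
        (if A.output n p.1 (fun i => (p.2 i, y i)) (x j) ≠ σ j then (1 : ENNReal) else 0) := by
    intro σ j
    refine Finset.measurable_sum _ fun y _ =>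
      (((P σ).measurable_prod_labelProb y).comp measurable_snd).mul ((hF σ j).comp
        (g := fun z : Ξ × (Fin w → Pt d × Bool) =>
          if A.output n z.1 z.2 (x j) ≠ σ j then (1 : ENNReal) else 0)
        (f := fun p : Ξ × (Fin w → Pt d) => (p.1, fun i => (p.2 i, y i))) ?_)
    fun_prop
  simp only [lintegral_prod_pi_law _ ν (hF _ _), hμ]
  simp only [← lintegral_finsetSum Finset.univ fun j _ => hmeas _ j]
  rw [← lintegral_finsetSum Finset.univ fun σ _ => Finset.measurable_sum _ fun j _ => hmeas σ j]
  calc ENNReal.ofReal (2 ^ m * (m / 8))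
      = ∫⁻ _ : Ξ × (Fin w → Pt d), ENNReal.ofReal (2 ^ m * (m / 8))
          ∂(ν.prod (Measure.pi fun _ : Fin w => μ)) := by simp
    _ ≤ _ := lintegral_mono fun p => ?_
  have key := sum_sum_labels_ge n (fun σ i => (P σ).eta (p.2 i)) (fun σ i => (P σ).eta_mem _)
    (fun j i => p.2 i ∈ s j) (fun i j j' => hs _ j j') (fun σ j i => hout σ j _)
    (fun σ j i => hin σ j _) (fun σ j i => hτ σ j _) hn (A.request p.1 p.2)
    (fun j b h => if A.classify p.1 p.2 h (x j) ≠ b then 1 else 0)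
    (fun j b h => by split_ifs <;> norm_num)
    (fun j b h => by cases A.classify p.1 p.2 h (x j) <;> cases b <;> simp)
  refine (ENNReal.ofReal_le_ofReal key).trans ?_
  have hnn : ∀ (σ : Fin m → Bool) (y : Fin w → Bool),
      0 ≤ ∏ i, labelProb ((P σ).eta (p.2 i)) (y i) := fun σ y =>
    Finset.prod_nonneg fun i _ => (P σ).labelProb_eta_nonneg _ _
  have hterm : ∀ (σ : Fin m → Bool) (j : Fin m) (y : Fin w → Bool),
      0 ≤ (∏ i, labelProb ((P σ).eta (p.2 i)) (y i)) *
        (if A.classify p.1 p.2 ((queryStep (A.request p.1 p.2) y)^[n] []) (x j) ≠ σ j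
          then 1 else 0) := fun σ j y => by
    refine mul_nonneg (hnn σ y) ?_
    split_ifs <;> norm_num
  rw [ENNReal.ofReal_sum_of_nonneg fun σ _ => Finset.sum_nonneg fun j _ =>
    Finset.sum_nonneg fun y _ => hterm σ j y]
  refine Finset.sum_le_sum fun σ _ => ?_
  rw [ENNReal.ofReal_sum_of_nonneg fun j _ => Finset.sum_nonneg fun y _ => hterm σ j y]
  refine Finset.sum_le_sum fun j _ => ?_
  rw [ENNReal.ofReal_sum_of_nonneg fun y _ => hterm σ j y]
  refine Finset.sum_le_sum fun y _ => ?_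
  rw [ENNReal.ofReal_mul (hnn σ y), ENNReal.ofReal_prod_of_nonneg fun i _ =>
    (P σ).labelProb_eta_nonneg _ _]
  refine mul_le_mul_right ?_ _
  rw [output, history_eq_iterate]
  split_ifs <;> simp

end ActiveLearner

/-! ### The one-dimensional family of profiles -/

/-- The points `h, 2h, …, mh`, at which the profiles take the value `1 / 2`. -/
def crossings (h : ℝ) (m : ℕ) : Set ℝ := Set.range fun j : Fin m => ((j : ℝ) + 1) * h

/-- The cell `[jh, (j + 1)h)`. -/
def cell (h : ℝ) (j : ℕ) : Set ℝ := Set.Ico (j * h) ((j + 1) * h)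

/-- The distance of the profiles from `1 / 2`: a multiple of the `a`-th power of the distance to the
crossings, capped at `1 / 2`. -/
noncomputable def amplitude (a κ h : ℝ) (m : ℕ) (t : ℝ) : ℝ :=
  min (1 / 2) (κ * Metric.infDist t (crossings h m) ^ a)

open Classical in
/-- The sign `±1` that is prescribed by `σ j` on the `j`-th cell, and `1` outside of the cells. -/
noncomputable def cellSign (h : ℝ) {m : ℕ} (σ : Fin m → Bool) (t : ℝ) : ℝ :=
  if ∀ j : Fin m, t ∈ cell h j → σ j = true then 1 else -1

/-- The regression function along the segment, with signs `σ` on the cells. -/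
noncomputable def profile (a κ h : ℝ) {m : ℕ} (σ : Fin m → Bool) (t : ℝ) : ℝ :=
  1 / 2 + cellSign h σ t * amplitude a κ h m t

theorem measurableSet_cell (h : ℝ) (j : ℕ) : MeasurableSet (cell h j) := measurableSet_Ico

theorem eq_of_mem_cell {h : ℝ} (hh : 0 < h) {j k : ℕ} {t : ℝ} (hj : t ∈ cell h j)
    (hk : t ∈ cell h k) : j = k := by
  have key : ∀ {j k : ℕ}, t ∈ cell h j → t ∈ cell h k → j ≤ k := by
    intro j k hj hk
    have h1 : (j : ℝ) < k + 1 := lt_of_mul_lt_mul_right (hj.1.trans_lt hk.2) hh.le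
    have h2 : j < k + 1 := by exact_mod_cast h1
    omega
  exact le_antisymm (key hj hk) (key hk hj)

section Profile

variable {a κ h : ℝ} {m : ℕ}

theorem cellSign_eq_or (σ : Fin m → Bool) (t : ℝ) : cellSign h σ t = 1 ∨ cellSign h σ t = -1 := by
  unfold cellSign
  split_ifs <;> simp

theorem cellSign_of_mem (hh : 0 < h) (σ : Fin m → Bool) {j : Fin m} {t : ℝ}
    (ht : t ∈ cell h j) : cellSign h σ t = if σ j = true then 1 else -1 := by
  classical
  unfold cellSign
  refine if_congr ⟨fun H => H j ht, fun H k hk => ?_⟩ rfl rfl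
  rw [← H, Fin.ext (eq_of_mem_cell hh hk ht)]

theorem cellSign_of_forall_notMem (σ : Fin m → Bool) {t : ℝ} (ht : ∀ j : Fin m, t ∉ cell h j) :
    cellSign h σ t = 1 :=
  if_pos fun j hj => absurd hj (ht j)

theorem cellSign_flip_of_mem (hh : 0 < h) (σ : Fin m → Bool) {j : Fin m} {t : ℝ}
    (ht : t ∈ cell h j) : cellSign h (Function.update σ j (!σ j)) t = -cellSign h σ t := by
  rw [cellSign_of_mem hh _ ht, cellSign_of_mem hh _ ht, Function.update_self]
  cases σ j <;> simp

theorem cellSign_flip_of_notMem (σ : Fin m → Bool) {j : Fin m} {t : ℝ} (ht : t ∉ cell h j) :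
    cellSign h (Function.update σ j (!σ j)) t = cellSign h σ t := by
  classical
  unfold cellSign
  refine if_congr (forall_congr' fun k => ?_) rfl rfl
  by_cases hk : k = j
  · subst hk
    simp [ht]
  · rw [Function.update_of_ne hk]

theorem measurable_cellSign (σ : Fin m → Bool) : Measurable (cellSign h σ) := by
  classical
  unfold cellSign
  refine Measurable.ite ?_ measurable_const measurable_const
  have : {t : ℝ | ∀ j : Fin m, t ∈ cell h j → σ j = true} =
      ⋂ j : Fin m, {t : ℝ | t ∈ cell h j → σ j = true} := by
    ext t
    simp
  rw [this]
  refine MeasurableSet.iInter fun j => ?_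
  by_cases hj : σ j = true
  · simp [hj]
  · have : {t : ℝ | t ∈ cell h j → σ j = true} = (cell h j)ᶜ := by
      ext t
      simp [hj]
    rw [this]
    exact (measurableSet_cell h j).compl

theorem measurable_amplitude : Measurable (amplitude a κ h m) := by
  unfold amplitude
  have h1 : Measurable fun t : ℝ => Metric.infDist t (crossings h m) :=
    (Metric.continuous_infDist_pt _).measurable
  exact measurable_const.min ((h1.pow_const a).const_mul κ)

theorem measurable_profile (σ : Fin m → Bool) : Measurable (profile a κ h σ) :=
  ((measurable_cellSign σ).mul measurable_amplitude).const_add _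

theorem amplitude_nonneg (hκ : 0 ≤ κ) (t : ℝ) : 0 ≤ amplitude a κ h m t :=
  le_min (by norm_num) (mul_nonneg hκ (Real.rpow_nonneg Metric.infDist_nonneg _))

theorem abs_profile_sub (hκ : 0 ≤ κ) (σ : Fin m → Bool) (t : ℝ) :
    |profile a κ h σ t - 1 / 2| = amplitude a κ h m t := by
  have h0 := amplitude_nonneg (a := a) (h := h) (m := m) hκ t
  rcases cellSign_eq_or (h := h) σ t with hs | hs
  · simp [profile, hs, abs_of_nonneg h0]
  · simp [profile, hs, abs_of_nonneg h0]

theorem profile_mem_Icc (hκ : 0 ≤ κ) (σ : Fin m → Bool) (t : ℝ) :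
    profile a κ h σ t ∈ Set.Icc (0 : ℝ) 1 := by
  have h1 : |profile a κ h σ t - 1 / 2| ≤ 1 / 2 := by
    rw [abs_profile_sub hκ]
    exact min_le_left _ _
  rw [abs_le] at h1
  constructor <;> linarith [h1.1, h1.2]

theorem amplitude_le_of_crossing (ha : 0 ≤ a) (hκ : 0 ≤ κ) {t z : ℝ} (hz : z ∈ crossings h m) :
    amplitude a κ h m t ≤ κ * |t - z| ^ a := by
  refine (min_le_right _ _).trans (mul_le_mul_of_nonneg_left ?_ hκ)
  rw [← Real.dist_eq]
  exact Real.rpow_le_rpow Metric.infDist_nonneg (Metric.infDist_le_dist_of_mem hz) ha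

theorem amplitude_le_of_mem_cell (ha : 0 ≤ a) (hκ : 0 ≤ κ) {j : Fin m} {t : ℝ}
    (ht : t ∈ cell h j) : amplitude a κ h m t ≤ κ * h ^ a := by
  refine (amplitude_le_of_crossing ha hκ ⟨j, rfl⟩).trans (mul_le_mul_of_nonneg_left ?_ hκ)
  refine Real.rpow_le_rpow (abs_nonneg _) ?_ ha
  have h1 := ht.1
  have h2 := ht.2
  dsimp only
  rw [abs_of_nonpos (by linarith)]
  linarith

theorem amplitude_le_add (ha : 0 ≤ a) (ha1 : a ≤ 1) (hκ : 0 ≤ κ) (t t' : ℝ) :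
    amplitude a κ h m t ≤ amplitude a κ h m t' + κ * |t - t'| ^ a := by
  have h1 : Metric.infDist t (crossings h m) ^ a ≤
      Metric.infDist t' (crossings h m) ^ a + |t - t'| ^ a := by
    refine le_trans (Real.rpow_le_rpow Metric.infDist_nonneg
      (Metric.infDist_le_infDist_add_dist (y := t')) ha) ?_
    rw [← Real.dist_eq]
    exact Real.rpow_add_le_add_rpow Metric.infDist_nonneg dist_nonneg ha ha1
  have h2 := mul_le_mul_of_nonneg_left h1 hκ
  have h3 : 0 ≤ κ * |t - t'| ^ a := mul_nonneg hκ (Real.rpow_nonneg (abs_nonneg _) _)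
  unfold amplitude
  rw [← min_add_add_right]
  exact min_le_min (by linarith) (by linarith)

theorem abs_amplitude_sub_le (ha : 0 ≤ a) (ha1 : a ≤ 1) (hκ : 0 ≤ κ) (t t' : ℝ) :
    |amplitude a κ h m t - amplitude a κ h m t'| ≤ κ * |t - t'| ^ a := by
  have h1 := amplitude_le_add (h := h) (m := m) ha ha1 hκ t t'
  have h2 := amplitude_le_add (h := h) (m := m) ha ha1 hκ t' t
  rw [abs_sub_comm t' t] at h2
  rw [abs_le]
  constructor <;> linarith

/-- Two points of the half-line with different signs are separated by a crossing. -/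
theorem exists_crossing_of_cellSign_ne (hh : 0 < h) (σ : Fin m → Bool) {t t' : ℝ} (ht : 0 ≤ t)
    (htt : t ≤ t') (hne : cellSign h σ t ≠ cellSign h σ t') :
    ∃ z ∈ crossings h m, t ≤ z ∧ z ≤ t' := by
  by_cases h1 : ∃ j : Fin m, t ∈ cell h j
  · obtain ⟨j, hj⟩ := h1
    refine ⟨_, ⟨j, rfl⟩, hj.2.le, ?_⟩
    by_contra hlt
    push Not at hlt
    have hj' : t' ∈ cell h j := ⟨hj.1.trans htt, hlt⟩
    exact hne (by rw [cellSign_of_mem hh σ hj, cellSign_of_mem hh σ hj'])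
  · push Not at h1
    by_cases h2 : ∃ j : Fin m, t' ∈ cell h j
    · obtain ⟨⟨j, hjm⟩, hj⟩ := h2
      have hlt : t < j * h := by
        by_contra hle
        push Not at hle
        exact h1 ⟨j, hjm⟩ ⟨hle, htt.trans_lt hj.2⟩
      rcases j with _ | j
      · simp at hlt
        linarith
      · refine ⟨_, ⟨⟨j, by omega⟩, rfl⟩, ?_, ?_⟩
        · push_cast at hlt
          exact hlt.le
        · have := hj.1
          push_cast at this
          exact this
    · push Not at h2
      exact absurd (by rw [cellSign_of_forall_notMem σ h1, cellSign_of_forall_notMem σ h2]) hne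

theorem rpow_add_rpow_le (ha : 0 ≤ a) (ha1 : a ≤ 1) {u v : ℝ} (hu : 0 ≤ u) (hv : 0 ≤ v) :
    2 ^ (a - 1) * (u ^ a + v ^ a) ≤ (u + v) ^ a := by
  have h1 := (Real.concaveOn_rpow ha ha1).2 (Set.mem_Ici.2 hu) (Set.mem_Ici.2 hv)
    (show (0 : ℝ) ≤ 1 / 2 by norm_num) (show (0 : ℝ) ≤ 1 / 2 by norm_num) (by norm_num)
  simp only [smul_eq_mul] at h1
  rw [← mul_add, ← mul_add, Real.mul_rpow (by norm_num) (by positivity)] at h1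
  have h2 : (2 : ℝ) ^ (a - 1) = 2 ^ a * (1 / 2) := by
    rw [Real.rpow_sub (by norm_num), Real.rpow_one]
    ring
  have h3 : (2 : ℝ) ^ a * (1 / 2) ^ a = 1 := by
    rw [← Real.mul_rpow (by norm_num) (by norm_num)]
    norm_num
  calc (2 : ℝ) ^ (a - 1) * (u ^ a + v ^ a) = 2 ^ a * (1 / 2 * (u ^ a + v ^ a)) := by
        rw [h2]; ring
    _ ≤ 2 ^ a * ((1 / 2) ^ a * (u + v) ^ a) := mul_le_mul_of_nonneg_left h1 (by positivity)
    _ = (u + v) ^ a := by rw [← mul_assoc, h3, one_mul]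

/-- The profiles are Hölder continuous with constant `L = κ 2 ^ (1 - a)`. Where the sign changes,
this is the concavity inequality `u ^ a + v ^ a ≤ 2 ^ (1 - a) (u + v) ^ a` for the distances `u` and
`v` to a crossing in between. -/
theorem abs_profile_sub_profile_le {L : ℝ} (ha : 0 ≤ a) (ha1 : a ≤ 1) (hL : 0 ≤ L)
    (hκ : κ = L * 2 ^ (a - 1)) (hh : 0 < h) (σ : Fin m → Bool) {t t' : ℝ} (ht : 0 ≤ t)
    (ht' : 0 ≤ t') : |profile a κ h σ t - profile a κ h σ t'| ≤ L * |t - t'| ^ a := by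
  wlog htt : t ≤ t' generalizing t t'
  · rw [abs_sub_comm, abs_sub_comm t t']
    exact this ht' ht (le_of_not_ge htt)
  have hκ0 : 0 ≤ κ := hκ ▸ by positivity
  have hκL : κ ≤ L := by
    rw [hκ]
    refine mul_le_of_le_one_right hL (Real.rpow_le_one_of_one_le_of_nonpos (by norm_num) ?_)
    linarith
  have hdiff : profile a κ h σ t - profile a κ h σ t' = cellSign h σ t * amplitude a κ h m t -
      cellSign h σ t' * amplitude a κ h m t' := by
    unfold profile
    ring
  rw [hdiff]
  by_cases hs : cellSign h σ t = cellSign h σ t'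
  · have h1 := abs_amplitude_sub_le (h := h) (m := m) ha ha1 hκ0 t t'
    have h2 : |cellSign h σ t'| = 1 := by
      rcases cellSign_eq_or (h := h) σ t' with h | h <;> simp [h]
    rw [hs, ← mul_sub, abs_mul, h2, one_mul]
    exact h1.trans (mul_le_mul_of_nonneg_right hκL (Real.rpow_nonneg (abs_nonneg _) _))
  · obtain ⟨z, hz, h1, h2⟩ := exists_crossing_of_cellSign_ne hh σ ht htt hs
    have h3 := amplitude_le_of_crossing (t := t) ha hκ0 hz
    have h4 := amplitude_le_of_crossing (t := t') ha hκ0 hz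
    rw [abs_sub_comm, abs_of_nonneg (by linarith)] at h3
    rw [abs_of_nonneg (by linarith)] at h4
    have h5 := rpow_add_rpow_le ha ha1 (sub_nonneg.2 h1) (sub_nonneg.2 h2)
    have h6 := mul_le_mul_of_nonneg_left h5 hL
    have h7 : z - t + (t' - z) = |t - t'| := by
      rw [abs_sub_comm, abs_of_nonneg (by linarith)]
      ring
    rw [h7, ← mul_assoc, ← hκ] at h6
    have h8 := amplitude_nonneg (a := a) (h := h) (m := m) hκ0 t
    have h9 := amplitude_nonneg (a := a) (h := h) (m := m) hκ0 t'
    have h10 : |cellSign h σ t * amplitude a κ h m t - cellSign h σ t' * amplitude a κ h m t'| ≤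
        amplitude a κ h m t + amplitude a κ h m t' := by
      refine (abs_sub _ _).trans ?_
      rw [abs_mul, abs_mul, abs_of_nonneg h8, abs_of_nonneg h9]
      have e : ∀ s, |cellSign h σ s| = 1 := fun s => by
        rcases cellSign_eq_or (h := h) σ s with h | h <;> simp [h]
      rw [e, e, one_mul, one_mul]
    linarith

/-- The middle half of a cell is at distance at least `h / 4` from all crossings. -/
theorem le_amplitude_of_mem_middle (hm : m ≠ 0) (ha : 0 ≤ a) (hκ : 0 ≤ κ)
    (hcap : κ * h ^ a ≤ 1 / 2) (hh : 0 < h) (j : ℕ) {s : ℝ}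
    (hs : s ∈ Set.Icc (h / 4) (3 * h / 4)) :
    κ * (h / 4) ^ a ≤ amplitude a κ h m (j * h + s) := by
  have hne : (crossings h m).Nonempty := ⟨_, ⟨⟨0, Nat.pos_of_ne_zero hm⟩, rfl⟩⟩
  have hle : h / 4 ≤ Metric.infDist (j * h + s) (crossings h m) := by
    rw [Metric.le_infDist hne]
    rintro _ ⟨k, rfl⟩
    rw [Real.dist_eq]
    obtain ⟨hs1, hs2⟩ := hs
    by_cases hk : (k : ℕ) + 1 ≤ j
    · have h1 : ((k : ℝ) + 1) ≤ j := by exact_mod_cast hk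
      refine le_trans ?_ (le_abs_self _)
      nlinarith
    · have h1 : (j : ℝ) ≤ k := by
        have : j ≤ (k : ℕ) := by omega
        exact_mod_cast this
      refine le_trans ?_ (neg_le_abs _)
      nlinarith
  refine le_min (le_trans (mul_le_mul_of_nonneg_left ?_ hκ) hcap)
    (mul_le_mul_of_nonneg_left (Real.rpow_le_rpow (by positivity) hle ha) hκ)
  exact Real.rpow_le_rpow (by positivity) (by linarith) ha

/-! ### The margin condition along the segment -/

theorem min_le_rpow_mul_rpow {b x y : ℝ} (hb : 0 ≤ b) (hb1 : b ≤ 1) (hx : 0 < x) (hy : 0 < y) :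
    min x y ≤ x ^ (1 - b) * y ^ b := by
  have h0 : 0 < min x y := lt_min hx hy
  calc min x y = min x y ^ (1 - b) * min x y ^ b := by
        rw [← Real.rpow_add h0, sub_add_cancel, Real.rpow_one]
    _ ≤ x ^ (1 - b) * y ^ b := by
        refine mul_le_mul (Real.rpow_le_rpow h0.le (min_le_left _ _) (by linarith))
          (Real.rpow_le_rpow h0.le (min_le_right _ _) hb) (by positivity) (by positivity)

/-- The neighbourhoods of the `m` crossings have length `2r` each, and they all lie in an interval of
length `(m - 1) h + 2r`. -/
theorem volume_infDist_crossings_lt (hm : m ≠ 0) (hh : 0 < h) (r : ℝ) :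
    volume {t : ℝ | Metric.infDist t (crossings h m) < r} ≤
      ENNReal.ofReal (((m : ℝ) - 1) * min h (2 * r) + 2 * r) := by
  have hm1 : (1 : ℝ) ≤ m := by exact_mod_cast Nat.one_le_iff_ne_zero.2 hm
  have hne : (crossings h m).Nonempty := ⟨_, ⟨⟨0, Nat.pos_of_ne_zero hm⟩, rfl⟩⟩
  have hsub : {t : ℝ | Metric.infDist t (crossings h m) < r} ⊆
      ⋃ j ∈ (Finset.univ : Finset (Fin m)), Metric.ball (((j : ℝ) + 1) * h) r := by
    intro t ht
    obtain ⟨_, ⟨j, rfl⟩, hj⟩ := (Metric.infDist_lt_iff hne).1 ht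
    simp only [Set.mem_iUnion]
    exact ⟨j, Finset.mem_univ _, hj⟩
  have h1 : volume {t : ℝ | Metric.infDist t (crossings h m) < r} ≤
      ENNReal.ofReal (m * (2 * r)) := by
    refine (measure_mono hsub).trans ((measure_biUnion_finset_le _ _).trans ?_)
    simp only [Real.volume_ball, Finset.sum_const, Finset.card_univ, Fintype.card_fin,
      nsmul_eq_mul]
    rw [ENNReal.ofReal_mul (p := (m : ℝ)) (by positivity), ENNReal.ofReal_natCast]
  have h2 : volume {t : ℝ | Metric.infDist t (crossings h m) < r} ≤
      ENNReal.ofReal ((m - 1) * h + 2 * r) := by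
    have hsub2 : {t : ℝ | Metric.infDist t (crossings h m) < r} ⊆ Set.Ioo (h - r) (m * h + r) := by
      intro t ht
      obtain ⟨_, ⟨j, rfl⟩, hj⟩ := (Metric.infDist_lt_iff hne).1 ht
      rw [Real.dist_eq, abs_lt] at hj
      have hj1 : (j : ℝ) + 1 ≤ m := by exact_mod_cast j.2
      have hj0 : (0 : ℝ) ≤ j := by positivity
      constructor <;> nlinarith [hj.1, hj.2]
    refine (measure_mono hsub2).trans ?_
    rw [Real.volume_Ioo]
    exact ENNReal.ofReal_le_ofReal (by linarith)
  rcases le_total h (2 * r) with hle | hle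
  · rwa [min_eq_left hle]
  · rw [min_eq_right hle]
    convert h1 using 2
    ring

/-- Tsybakov's margin condition for the uniform distribution on the segment. -/
theorem volume_amplitude_lt {β L ε : ℝ} (hm : m ≠ 0) (ha : 0 < a) (hβ : 0 < β) (hL : 1 < L)
    (hab : a * β ≤ 1) (hκ : κ = L * 2 ^ (a - 1)) (hh : 0 < h)
    (hmh : ((m : ℝ) - 1) * h ^ (1 - a * β) + 1 < L ^ β) (hε : 0 < ε) :
    volume {t ∈ Set.Icc (0 : ℝ) 1 | amplitude a κ h m t < ε} <
      ENNReal.ofReal ((2 * ε) ^ β) := by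
  have hle1 : volume {t ∈ Set.Icc (0 : ℝ) 1 | amplitude a κ h m t < ε} ≤ ENNReal.ofReal 1 := by
    refine (measure_mono (Set.sep_subset _ _)).trans ?_
    simp
  have hlarge : 1 < (2 * ε) ^ β → volume {t ∈ Set.Icc (0 : ℝ) 1 | amplitude a κ h m t < ε} <
      ENNReal.ofReal ((2 * ε) ^ β) := fun h1 =>
    hle1.trans_lt ((ENNReal.ofReal_lt_ofReal_iff (by linarith)).2 h1)
  -- For `ε > 1 / 2` and for `2r > 1` the right-hand side exceeds the total mass.
  rcases lt_or_ge (1 / 2) ε with hε2 | hε2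
  · exact hlarge (Real.one_lt_rpow (by linarith) hβ)
  have hL0 : 0 < L := by linarith
  have hκ0 : 0 < κ := hκ ▸ by positivity
  set r : ℝ := (ε / κ) ^ a⁻¹ with hr
  have hr0 : 0 < r := by positivity
  have hra : r ^ a = ε / κ := by
    rw [hr, ← Real.rpow_mul (by positivity), inv_mul_cancel₀ ha.ne', Real.rpow_one]
  have h2ε : 2 * ε = L * (2 * r) ^ a := by
    have h1 : ε = κ * r ^ a := by
      rw [hra]
      field_simp
    rw [Real.mul_rpow (by norm_num) hr0.le, h1, hκ, Real.rpow_sub (by norm_num), Real.rpow_one]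
    ring
  have h2εβ : (2 * ε) ^ β = L ^ β * (2 * r) ^ (a * β) := by
    rw [h2ε, Real.mul_rpow hL0.le (by positivity), ← Real.rpow_mul (by positivity)]
  have hLβ : 1 < L ^ β := Real.one_lt_rpow hL hβ
  have hab0 : 0 < a * β := by positivity
  rcases lt_or_ge 1 (2 * r) with hr1 | hr1
  · refine hlarge ?_
    rw [h2εβ]
    exact one_lt_mul hLβ.le (Real.one_lt_rpow hr1 hab0)
  have hsub : {t ∈ Set.Icc (0 : ℝ) 1 | amplitude a κ h m t < ε} ⊆
      {t : ℝ | Metric.infDist t (crossings h m) < r} := by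
    rintro t ⟨-, ht⟩
    -- As `ε ≤ 1 / 2`, the cap in the amplitude is not active.
    have h1 : κ * Metric.infDist t (crossings h m) ^ a < ε := by
      rcases min_lt_iff.1 ht with h1 | h1
      · linarith
      · exact h1
    have h2 : Metric.infDist t (crossings h m) ^ a < r ^ a := by
      rw [hra, lt_div_iff₀ hκ0]
      linarith
    exact (Real.rpow_lt_rpow_iff Metric.infDist_nonneg hr0.le ha).1 h2
  refine (measure_mono hsub).trans_lt ((volume_infDist_crossings_lt hm hh r).trans_lt ?_)
  have hpos : 0 < (2 * r) ^ (a * β) := by positivity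
  rw [ENNReal.ofReal_lt_ofReal_iff (by positivity), h2εβ]
  have hm1 : (0 : ℝ) ≤ m - 1 := by
    have : (1 : ℝ) ≤ m := by exact_mod_cast Nat.one_le_iff_ne_zero.2 hm
    linarith
  have h3 := mul_le_mul_of_nonneg_left
    (min_le_rpow_mul_rpow hab0.le hab hh (by positivity : 0 < 2 * r)) hm1
  have h4 : 2 * r ≤ (2 * r) ^ (a * β) := by
    conv_lhs => rw [← Real.rpow_one (2 * r)]
    exact Real.rpow_le_rpow_of_exponent_ge (by positivity) hr1 hab
  calc ((m : ℝ) - 1) * min h (2 * r) + 2 * r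
      ≤ (((m : ℝ) - 1) * h ^ (1 - a * β) + 1) * (2 * r) ^ (a * β) := by linarith
    _ < L ^ β * (2 * r) ^ (a * β) := mul_lt_mul_of_pos_right hmh hpos

end Profile

/-! ### The hypotheses: distributions on a segment of the cube -/

section Segment

variable {d : ℕ}

/-- The embedding of the real line as the `i`-th coordinate axis. -/
noncomputable def axis (i : Fin d) (t : ℝ) : Pt d := EuclideanSpace.single i t

theorem axis_apply_self (i : Fin d) (t : ℝ) : axis i t i = t := by
  simp [axis]

theorem dist_axis (i : Fin d) (s t : ℝ) : dist (axis i s) (axis i t) = |s - t| := by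
  rw [axis, axis, PiLp.dist_single_same, Real.dist_eq]

theorem continuous_axis (i : Fin d) : Continuous (axis i) :=
  (Isometry.of_dist_eq fun s t => by rw [dist_axis, Real.dist_eq]).continuous

theorem measurable_axis (i : Fin d) : Measurable (axis i) := (continuous_axis i).measurable

/-- The uniform distribution on the segment from `0` to the `i`-th unit vector. -/
noncomputable def segmentMeasure (i : Fin d) : Measure (Pt d) :=
  (volume.restrict (Set.Icc (0 : ℝ) 1)).map (axis i)

instance (i : Fin d) : IsProbabilityMeasure (segmentMeasure i) := by
  have : IsProbabilityMeasure (volume.restrict (Set.Icc (0 : ℝ) 1)) := ⟨by simp⟩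
  exact Measure.isProbabilityMeasure_map (measurable_axis i).aemeasurable

theorem support_segmentMeasure_subset (i : Fin d) :
    (segmentMeasure i).support ⊆ axis i '' Set.Icc 0 1 := by
  have hc : IsClosed (axis i '' Set.Icc (0 : ℝ) 1) :=
    (isCompact_Icc.image (continuous_axis i)).isClosed
  refine Measure.support_subset_of_isClosed hc ?_
  rw [mem_ae_iff, segmentMeasure, Measure.map_apply (measurable_axis i) hc.measurableSet.compl,
    Measure.restrict_apply (measurable_axis i hc.measurableSet.compl)]
  have : axis i ⁻¹' (axis i '' Set.Icc 0 1)ᶜ ∩ Set.Icc 0 1 = ∅ := by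
    ext t
    simp only [Set.mem_inter_iff, Set.mem_preimage, Set.mem_compl_iff, Set.mem_empty_iff_false,
      iff_false, not_and]
    exact fun h ht => h ⟨t, ht, rfl⟩
  rw [this, measure_empty]

theorem segmentMeasure_apply (i : Fin d) {s : Set (Pt d)} (hs : MeasurableSet s) :
    segmentMeasure i s = volume {t ∈ Set.Icc (0 : ℝ) 1 | axis i t ∈ s} := by
  rw [segmentMeasure, Measure.map_apply (measurable_axis i) hs,
    Measure.restrict_apply (measurable_axis i hs), Set.inter_comm]
  rfl

/-- Because of this bound, smoothness with respect to the marginal follows from Hölder continuity with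
exponent `α / d` along the segment, whatever the dimension is. -/
theorem le_segmentMeasure_ball (i : Fin d) {s t : ℝ} (hs : s ∈ Set.Icc (0 : ℝ) 1)
    (ht : t ∈ Set.Icc (0 : ℝ) 1) :
    |s - t| ≤ (segmentMeasure i).real (Metric.ball (axis i s) (dist (axis i s) (axis i t))) := by
  rw [Measure.real, ← ENNReal.ofReal_le_iff_le_toReal (measure_ne_top _ _),
    segmentMeasure_apply i Metric.isOpen_ball.measurableSet]
  have key : ∀ x y : ℝ, 0 ≤ x → y ≤ 1 → (∀ u ∈ Set.Ioo x y, |u - s| < |s - t|) →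
      ENNReal.ofReal (y - x) ≤ volume {u ∈ Set.Icc (0 : ℝ) 1 |
        axis i u ∈ Metric.ball (axis i s) (dist (axis i s) (axis i t))} := by
    intro x y hx hy h
    rw [← Real.volume_Ioo]
    refine measure_mono fun u hu => ⟨⟨by linarith [hu.1], by linarith [hu.2]⟩, ?_⟩
    rw [Metric.mem_ball, dist_axis, dist_axis]
    exact h u hu
  rcases le_total s t with hst | hst
  · rw [abs_of_nonpos (by linarith), neg_sub]
    refine key s t hs.1 ht.2 fun u hu => ?_
    rw [abs_of_pos (by linarith [hu.1]), abs_of_nonpos (by linarith)]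
    linarith [hu.2]
  · rw [abs_of_nonneg (by linarith)]
    refine key t s ht.1 hs.2 fun u hu => ?_
    rw [abs_of_neg (by linarith [hu.2]), abs_of_nonneg (by linarith)]
    linarith [hu.1]

/-- The uniform distribution on a segment, with a profile as its regression function. -/
noncomputable def profileDist (i : Fin d) (a : ℝ) {κ : ℝ} (hκ : 0 ≤ κ) (h : ℝ) {m : ℕ}
    (σ : Fin m → Bool) : LabelledDist d where
  marginal := segmentMeasure i
  eta x := profile a κ h σ (x i)
  isProbabilityMeasure_marginal := inferInstance
  measurable_eta := (measurable_profile σ).comp (by fun_prop)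
  eta_mem x := profile_mem_Icc hκ σ _

variable {i : Fin d} {a κ h : ℝ} {m : ℕ}

theorem profileDist_eta (hκ : 0 ≤ κ) (σ : Fin m → Bool) (x : Pt d) :
    (profileDist i a hκ h σ).eta x = profile a κ h σ (x i) := rfl

theorem profileDist_marginal (hκ : 0 ≤ κ) (σ : Fin m → Bool) :
    (profileDist i a hκ h σ).marginal = segmentMeasure i := rfl

theorem profileDist_mem_distClass {α β L C : ℝ} (hα : 0 < α) (hα1 : α ≤ 1) (hβ : 0 < β)
    (hL : 1 < L) (hC : (2 : ℝ) ^ β ≤ C) (hαβ : α * β ≤ d) (hm : m ≠ 0) (hκ0 : 0 ≤ κ)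
    (hκ : κ = L * 2 ^ (α / d - 1)) (hh : 0 < h)
    (hmh : ((m : ℝ) - 1) * h ^ (1 - α / d * β) + 1 < L ^ β) (σ : Fin m → Bool) :
    profileDist i (α / d) hκ0 h σ ∈ distClass d α β L C := by
  have hd : (1 : ℝ) ≤ d := by exact_mod_cast i.pos
  have hd0 : (0 : ℝ) < d := by linarith
  have ha : 0 < α / d := by positivity
  have ha1 : α / d ≤ 1 := by
    rw [div_le_one hd0]
    linarith
  refine ⟨?_, ?_, ?_⟩
  · refine (support_segmentMeasure_subset i).trans ?_
    rintro _ ⟨t, ht, rfl⟩ k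
    by_cases hk : k = i
    · rw [hk, axis_apply_self]
      exact ht
    · simp [axis, hk]
  · intro x hx x' hx'
    obtain ⟨t, ht, rfl⟩ := support_segmentMeasure_subset i hx
    obtain ⟨t', ht', rfl⟩ := support_segmentMeasure_subset i hx'
    rw [profileDist_eta, profileDist_eta, axis_apply_self, axis_apply_self]
    refine (abs_profile_sub_profile_le ha.le ha1 (by linarith) hκ hh σ ht.1 ht'.1).trans ?_
    exact mul_le_mul_of_nonneg_left (Real.rpow_le_rpow (abs_nonneg _)
      (le_segmentMeasure_ball i ht ht') ha.le) (by linarith)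
  · intro ε hε _
    have hab : α / d * β ≤ 1 := by
      rw [div_mul_eq_mul_div, div_le_one hd0]
      exact hαβ
    have h1 := volume_amplitude_lt hm ha hβ hL hab hκ hh hmh hε
    have h2 : (profileDist i (α / d) hκ0 h σ).marginal
        {x | |(profileDist i (α / d) hκ0 h σ).eta x - 1 / 2| < ε} =
        volume {t ∈ Set.Icc (0 : ℝ) 1 | amplitude (α / d) κ h m t < ε} := by
      have hmeas : MeasurableSet {x | |(profileDist i (α / d) hκ0 h σ).eta x - 1 / 2| < ε} :=
        measurableSet_lt ((profileDist i (α / d) hκ0 h σ).measurable_eta.sub_const _).abs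
          measurable_const
      rw [profileDist_marginal, segmentMeasure_apply i hmeas]
      congr 1
      ext t
      simp only [Set.mem_ofPred_eq, profileDist_eta, axis_apply_self, abs_profile_sub hκ0]
    rw [Measure.real, h2]
    have h3 : (2 * ε) ^ β ≤ C * ε ^ β := by
      rw [Real.mul_rpow (by norm_num) hε.le]
      exact mul_le_mul_of_nonneg_right hC (by positivity)
    refine lt_of_lt_of_le ?_ h3
    rw [← ENNReal.toReal_ofReal (by positivity : 0 ≤ (2 * ε) ^ β)]
    exact (ENNReal.toReal_lt_toReal h1.ne_top ENNReal.ofReal_ne_top).2 h1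

/-- On the middle half of each cell, a wrong sign costs at least `2 κ (h / 4) ^ a`. -/
theorem lintegral_error_le_ofReal_excessRisk (hm : m ≠ 0) (ha : 0 ≤ a) (hκ : 0 < κ)
    (hcap : κ * h ^ a ≤ 1 / 2) (hh : 0 < h) (hmh : m * h ≤ 1) (σ : Fin m → Bool)
    {f : Pt d → Bool} (hf : Measurable f) :
    ∫⁻ s in Set.Icc (h / 4) (3 * h / 4), ∑ j : Fin m, ENNReal.ofReal (2 * (κ * (h / 4) ^ a)) *
        (if f (axis i (j * h + s)) ≠ σ j then 1 else 0) ≤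
      ENNReal.ofReal ((profileDist i a hκ.le h σ).excessRisk f) := by
  set P := profileDist i a hκ.le h σ with hP
  rw [P.ofReal_excessRisk hf]
  set g : Pt d → ENNReal := fun x =>
    if f x ≠ P.bayes x then ENNReal.ofReal |2 * P.eta x - 1| else 0 with hg
  have hgm : Measurable g := Measurable.ite
    (measurableSet_eq_fun hf P.measurable_bayes).compl
    ((P.measurable_eta.const_mul 2).sub_const 1).abs.ennreal_ofReal measurable_const
  have hmar : ∫⁻ x, g x ∂P.marginal = ∫⁻ t in Set.Icc (0 : ℝ) 1, g (axis i t) :=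
    lintegral_map hgm (measurable_axis i)
  have hgax : Measurable fun t => g (axis i t) := hgm.comp (measurable_axis i)
  have hmid : ∀ (j : Fin m) (s : ℝ), s ∈ Set.Icc (h / 4) (3 * h / 4) →
      (j : ℝ) * h + s ∈ cell h j := by
    intro j s hs
    constructor <;> nlinarith [hs.1, hs.2]
  have hpt : ∀ (j : Fin m) (s : ℝ), s ∈ Set.Icc (h / 4) (3 * h / 4) →
      ENNReal.ofReal (2 * (κ * (h / 4) ^ a)) *
        (if f (axis i (j * h + s)) ≠ σ j then 1 else 0) ≤ g (axis i (j * h + s)) := by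
    intro j s hs
    have hamp := le_amplitude_of_mem_middle hm ha hκ.le hcap hh j hs
    have hpos : 0 < κ * (h / 4) ^ a := by positivity
    have heta : P.eta (axis i (j * h + s)) = 1 / 2 + (if σ j = true then 1 else -1) *
        amplitude a κ h m (j * h + s) := by
      rw [hP, profileDist_eta, axis_apply_self, profile, cellSign_of_mem hh σ (hmid j s hs)]
    have hb : P.bayes (axis i (j * h + s)) = σ j := by
      rw [LabelledDist.bayes, heta]
      cases σ j
      · simp
        linarith
      · simp
        linarith
    have habs : |2 * P.eta (axis i (j * h + s)) - 1| = 2 * amplitude a κ h m (j * h + s) := by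
      have h1 := abs_profile_sub (a := a) (h := h) hκ.le σ (j * h + s)
      rw [show 2 * P.eta (axis i (j * h + s)) - 1 =
        2 * (profile a κ h σ (j * h + s) - 1 / 2) by
          rw [hP, profileDist_eta, axis_apply_self]; ring, abs_mul, h1]
      norm_num
    rw [hg]
    dsimp only
    rw [hb, habs]
    split_ifs
    · rw [mul_one]
      exact ENNReal.ofReal_le_ofReal (by linarith)
    · simp
  have hshift : ∀ j : Fin m, ∫⁻ s in Set.Icc (h / 4) (3 * h / 4), g (axis i (j * h + s)) =
      ∫⁻ t in Set.Icc (j * h + h / 4) (j * h + 3 * h / 4), g (axis i t) := by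
    intro j
    rw [← lintegral_indicator measurableSet_Icc, ← lintegral_indicator measurableSet_Icc,
      ← lintegral_add_left_eq_self ((Set.Icc ((j : ℝ) * h + h / 4) (j * h + 3 * h / 4)).indicator
        fun t => g (axis i t)) ((j : ℝ) * h)]
    refine lintegral_congr fun s => ?_
    simp only [Set.indicator, Set.mem_Icc, add_le_add_iff_left]
  have hcell : ∀ j : Fin m, Set.Icc ((j : ℝ) * h + h / 4) (j * h + 3 * h / 4) ⊆ cell h j := by
    intro j t ht
    constructor <;> nlinarith [ht.1, ht.2]
  calc ∫⁻ s in Set.Icc (h / 4) (3 * h / 4), ∑ j : Fin m, ENNReal.ofReal (2 * (κ * (h / 4) ^ a)) *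
        (if f (axis i (j * h + s)) ≠ σ j then 1 else 0)
      ≤ ∫⁻ s in Set.Icc (h / 4) (3 * h / 4), ∑ j : Fin m, g (axis i (j * h + s)) :=
        setLIntegral_mono' measurableSet_Icc fun s hs =>
          Finset.sum_le_sum fun j _ => hpt j s hs
    _ = ∑ j : Fin m, ∫⁻ s in Set.Icc (h / 4) (3 * h / 4), g (axis i (j * h + s)) :=
        lintegral_finsetSum _ fun j _ => hgax.comp (measurable_const_add _)
    _ = ∑ j : Fin m, ∫⁻ t in Set.Icc (j * h + h / 4) (j * h + 3 * h / 4), g (axis i t) :=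
        Finset.sum_congr rfl fun j _ => hshift j
    _ = ∫⁻ t in ⋃ j ∈ (Finset.univ : Finset (Fin m)),
          Set.Icc (j * h + h / 4) (j * h + 3 * h / 4), g (axis i t) := by
        refine (lintegral_biUnion_finset (fun j _ k _ hjk => ?_)
          (fun j _ => measurableSet_Icc) _).symm
        refine Set.disjoint_left.2 fun t hj hk => hjk ?_
        exact Fin.ext (eq_of_mem_cell hh (hcell j hj) (hcell k hk))
    _ ≤ ∫⁻ t in Set.Icc (0 : ℝ) 1, g (axis i t) := by
        refine lintegral_mono_set ?_
        simp only [Set.iUnion_subset_iff]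
        intro j _ t ht
        have h1 := hcell j ht
        have h2 : (j : ℝ) + 1 ≤ m := by exact_mod_cast j.2
        have h3 : (0 : ℝ) ≤ j * h := by positivity
        exact ⟨h3.trans h1.1, by nlinarith [h1.2]⟩
    _ = ∫⁻ x, g x ∂P.marginal := hmar.symm
    _ = _ := rfl

end Segment

/-! ### The lower bound -/

namespace ActiveLearner

/-- The average over the signs of the expected excess risk of an active learner whose budget is too
small for the noise level `κ h ^ a` of the cells. -/
theorem sum_expectedExcessRisk_ge {Ξ : Type*} [MeasurableSpace Ξ] {d w m : ℕ} (i : Fin d)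
    {a κ h : ℝ} (hm : m ≠ 0) (ha : 0 ≤ a) (hκ : 0 < κ) (hcap : κ * h ^ a ≤ 1 / 2) (hh : 0 < h)
    (hmh : m * h ≤ 1) (n : ℕ) (hn : 16 * (κ * h ^ a) ^ 2 * n ≤ m) (A : ActiveLearner Ξ d w)
    (ν : Measure Ξ) [IsProbabilityMeasure ν] :
    ENNReal.ofReal (2 ^ m * (κ * (h / 4) ^ a * h * m / 8)) ≤
      ∑ σ : Fin m → Bool, A.expectedExcessRisk ν n (profileDist i a hκ.le h σ) := by
  set P : (Fin m → Bool) → LabelledDist d := fun σ => profileDist i a hκ.le h σ with hP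
  set v : ℝ := 2 * (κ * (h / 4) ^ a) with hv
  have hv0 : 0 ≤ v := by positivity
  -- The indicator of an error at the point `s` of the cell `j`, as a function of `(z, s)`.
  set e : (Fin m → Bool) → Fin m → (Ξ × (Fin w → Pt d × Bool)) → ℝ → ENNReal := fun σ j z s =>
    if A.output n z.1 z.2 (axis i (j * h + s)) ≠ σ j then 1 else 0 with he
  have hem : ∀ σ j, Measurable fun p : (Ξ × (Fin w → Pt d × Bool)) × ℝ => e σ j p.1 p.2 := by
    intro σ j
    have h1 : Measurable fun p : (Ξ × (Fin w → Pt d × Bool)) × ℝ =>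
        (p.1, axis i ((j : ℝ) * h + p.2)) :=
      measurable_fst.prodMk ((measurable_axis i).comp (measurable_snd.const_add _))
    exact Measurable.ite (((A.measurable_output n).comp h1) (measurableSet_singleton (σ j))).compl
      measurable_const measurable_const
  have hsum : ∀ σ, Measurable fun p : (Ξ × (Fin w → Pt d × Bool)) × ℝ =>
      ∑ j, ENNReal.ofReal v * e σ j p.1 p.2 := fun σ =>
    Finset.measurable_sum _ fun j _ => (hem σ j).const_mul _
  set I : Set ℝ := Set.Icc (h / 4) (3 * h / 4) with hI
  set Q : (Fin m → Bool) → Measure (Ξ × (Fin w → Pt d × Bool)) := fun σ =>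
    ν.prod (Measure.pi fun _ : Fin w => (P σ).law) with hQ
  have hexp : ∀ σ, ∫⁻ s in I, ∑ j, ENNReal.ofReal v * ∫⁻ z, e σ j z s ∂Q σ ≤
      A.expectedExcessRisk ν n (P σ) := by
    intro σ
    calc ∫⁻ s in I, ∑ j, ENNReal.ofReal v * ∫⁻ z, e σ j z s ∂Q σ
        = ∫⁻ s in I, ∫⁻ z, ∑ j, ENNReal.ofReal v * e σ j z s ∂Q σ := by
          refine lintegral_congr fun s => ?_
          have hes : ∀ j, Measurable fun z => e σ j z s := fun j =>
            (hem σ j).comp measurable_prodMk_right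
          rw [lintegral_finsetSum _ fun j _ => (hes j).const_mul _]
          exact Finset.sum_congr rfl fun j _ => (lintegral_const_mul _ (hes j)).symm
      _ = ∫⁻ z, (∫⁻ s in I, ∑ j, ENNReal.ofReal v * e σ j z s) ∂Q σ :=
          (lintegral_lintegral_swap (hsum σ).aemeasurable).symm
      _ ≤ A.expectedExcessRisk ν n (P σ) := by
          refine lintegral_mono fun z => ?_
          exact lintegral_error_le_ofReal_excessRisk hm ha hκ hcap hh hmh σ
            ((A.measurable_output n).comp measurable_prodMk_left)
  have hpoint : ∀ s, ENNReal.ofReal (v * (2 ^ m * (m / 8))) ≤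
      ∑ σ, ∑ j, ENNReal.ofReal v * ∫⁻ z, e σ j z s ∂Q σ := by
    intro s
    simp only [← Finset.mul_sum]
    rw [ENNReal.ofReal_mul hv0]
    refine mul_le_mul_right ?_ _
    refine A.sum_sum_lintegral_error_ge n ν (segmentMeasure i) P (fun σ => rfl)
      (τ := κ * h ^ a) (fun j => {x | x i ∈ cell h j}) ?_ ?_ ?_ ?_ hn
      fun j => axis i (j * h + s)
    · exact fun x j j' hj hj' => Fin.ext (eq_of_mem_cell hh hj hj')
    · intro σ j x hx
      simp only [hP, profileDist_eta, profile]
      rw [cellSign_flip_of_notMem σ hx]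
    · intro σ j x hx
      simp only [hP, profileDist_eta, profile]
      rw [cellSign_flip_of_mem hh σ hx]
      ring
    · intro σ j x hx
      rw [hP, profileDist_eta, abs_profile_sub hκ.le]
      exact amplitude_le_of_mem_cell ha hκ.le hx
  calc ENNReal.ofReal (2 ^ m * (κ * (h / 4) ^ a * h * m / 8))
      = ∫⁻ _ in I, ENNReal.ofReal (v * (2 ^ m * (m / 8))) := by
        rw [setLIntegral_const, hI, Real.volume_Icc, ← ENNReal.ofReal_mul (by positivity), hv]
        congr 1
        ring
    _ ≤ ∫⁻ s in I, ∑ σ, ∑ j, ENNReal.ofReal v * ∫⁻ z, e σ j z s ∂Q σ :=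
        lintegral_mono fun s => hpoint s
    _ = ∑ σ, ∫⁻ s in I, ∑ j, ENNReal.ofReal v * ∫⁻ z, e σ j z s ∂Q σ :=
        lintegral_finsetSum _ fun σ _ => Finset.measurable_sum _ fun j _ =>
          (Measurable.lintegral_prod_left' (hem σ j)).const_mul _
    _ ≤ _ := Finset.sum_le_sum fun σ _ => hexp σ

end ActiveLearner

/-- The scale `h` and the number `m` of the cells for a budget of `n` labels: there are of the order
of `h ^ (b - 1)` cells, each of which needs of the order of `h ^ (-2 a)` labels. -/
theorem exists_scale {a b κ δ : ℝ} (ha : 0 < a) (hb : 0 < b) (hb1 : b ≤ 1) (hκ : 0 < κ)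
    (hδ : 0 < δ) :
    ∃ c : ℝ, 0 < c ∧ ∀ n : ℕ, 1 ≤ n → ∃ (h : ℝ) (m : ℕ), 0 < h ∧ m ≠ 0 ∧
      ((m : ℝ) - 1) * h ^ (1 - b) ≤ δ ∧ κ * h ^ a ≤ 1 / 2 ∧ m * h ≤ 1 ∧
      16 * (κ * h ^ a) ^ 2 * n ≤ m ∧
      c * (n : ℝ) ^ (-((a + b) / (2 * a + 1 - b))) ≤ κ * (h / 4) ^ a * h * m / 8 := by
  set q : ℝ := 2 * a + 1 - b with hq
  have hq0 : 0 < q := by linarith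
  have hsmall : ∀ p : ℝ, 0 < p → ∀ r : ℝ, 0 < r → ∀ᶠ c in nhdsWithin (0 : ℝ) (Set.Ioi 0),
      c ^ p < r := by
    intro p hp r hr
    have h1 : Filter.Tendsto (fun c : ℝ => c ^ p) (nhds 0) (nhds 0) := by
      have := (Real.continuous_rpow_const hp.le).tendsto (0 : ℝ)
      rwa [Real.zero_rpow hp.ne'] at this
    exact (h1.mono_left nhdsWithin_le_nhds).eventually (gt_mem_nhds hr)
  obtain ⟨c, ⟨⟨⟨h1, h2⟩, h3⟩, h4⟩, hc⟩ := ((((hsmall 1 one_pos (1 / 2) (by norm_num)).and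
    (hsmall b hb (1 / (2 * δ)) (by positivity))).and
    (hsmall a ha (1 / (2 * κ)) (by positivity))).and
    (hsmall q hq0 (δ / (16 * κ ^ 2)) (by positivity))).and self_mem_nhdsWithin |>.exists
  replace hc : 0 < c := hc
  rw [Real.rpow_one] at h1
  rw [lt_div_iff₀ (by positivity)] at h2 h3 h4
  refine ⟨κ * (1 / 4) ^ a * δ / 8 * c ^ (a + b), by positivity, fun n hn => ?_⟩
  have hn0 : (0 : ℝ) < n := by exact_mod_cast hn
  have hn1 : (1 : ℝ) ≤ n := by exact_mod_cast hn
  set h : ℝ := c * (n : ℝ) ^ (-(1 / q)) with hh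
  have hh0 : 0 < h := by positivity
  have hhc : h ≤ c := by
    refine mul_le_of_le_one_right hc.le (Real.rpow_le_one_of_one_le_of_nonpos hn1 ?_)
    rw [neg_nonpos]
    positivity
  have hha : h ^ a ≤ c ^ a := Real.rpow_le_rpow hh0.le hhc ha.le
  have hhb : h ^ b ≤ c ^ b := Real.rpow_le_rpow hh0.le hhc hb.le
  have hpow : ∀ p : ℝ, h ^ p = c ^ p * (n : ℝ) ^ (-(p / q)) := by
    intro p
    rw [hh, Real.mul_rpow hc.le (by positivity), ← Real.rpow_mul hn0.le]
    congr 2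
    ring
  have hhq : h ^ q * n = c ^ q := by
    rw [hpow q, div_self hq0.ne', Real.rpow_neg_one]
    field_simp
  set M : ℕ := ⌊δ * h ^ (b - 1)⌋₊ with hM
  have hM1 : (M : ℝ) ≤ δ * h ^ (b - 1) := Nat.floor_le (by positivity)
  have hM2 : δ * h ^ (b - 1) ≤ (M + 1 : ℕ) := by
    push_cast
    exact (Nat.lt_floor_add_one _).le
  have hb0 : h ^ (b - 1) * h = h ^ b := by
    conv_lhs => rw [← Real.rpow_one h, ← Real.rpow_mul hh0.le, one_mul, ← Real.rpow_add hh0]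
    congr 1
    ring
  refine ⟨h, M + 1, hh0, by omega, ?_, ?_, ?_, ?_, ?_⟩
  · push_cast
    rw [add_sub_cancel_right]
    calc (M : ℝ) * h ^ (1 - b) ≤ δ * h ^ (b - 1) * h ^ (1 - b) :=
          mul_le_mul_of_nonneg_right hM1 (by positivity)
      _ = δ := by
          rw [mul_assoc, ← Real.rpow_add hh0, show b - 1 + (1 - b) = 0 by ring, Real.rpow_zero,
            mul_one]
  · nlinarith
  · push_cast
    have := mul_le_mul_of_nonneg_right hM1 hh0.le
    rw [mul_assoc, hb0] at this
    nlinarith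
  · refine le_trans ?_ hM2
    have e : (h ^ a) ^ 2 = h ^ q * h ^ (b - 1) := by
      rw [← Real.rpow_natCast, ← Real.rpow_mul hh0.le, ← Real.rpow_add hh0]
      congr 1
      rw [hq]
      push_cast
      ring
    calc 16 * (κ * h ^ a) ^ 2 * n = (h ^ q * n) * (16 * κ ^ 2) * h ^ (b - 1) := by
          rw [mul_pow, e]
          ring
      _ ≤ δ * h ^ (b - 1) := by
          rw [hhq]
          exact mul_le_mul_of_nonneg_right h4.le (by positivity)
  · have e : (h / 4) ^ a * h * (δ * h ^ (b - 1)) = (1 / 4) ^ a * δ * h ^ (a + b) := by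
      rw [show h / 4 = 1 / 4 * h by ring, Real.mul_rpow (by norm_num) hh0.le, Real.rpow_add hh0,
        ← hb0]
      ring
    calc κ * (1 / 4) ^ a * δ / 8 * c ^ (a + b) * (n : ℝ) ^ (-((a + b) / q))
        = κ * ((h / 4) ^ a * h * (δ * h ^ (b - 1))) / 8 := by
          rw [e, hpow]
          ring
      _ ≤ κ * ((h / 4) ^ a * h * (M + 1 : ℕ)) / 8 := by gcongr
      _ = κ * (h / 4) ^ a * h * (M + 1 : ℕ) / 8 := by ring

theorem theorem3 (d : ℕ) (α β L C : ℝ) (hα : 0 < α) (hα1 : α ≤ 1) (hβ : 0 < β)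
    (hL : 1 < L) (hC : (2 : ℝ) ^ β ≤ C) (hαβ : α * β ≤ d) :
    ∃ γ : ℝ, 0 < γ ∧ ∃ N : ℕ, ∀ n : ℕ, N ≤ n →
      ∀ (w : ℕ) (Ξ : Type*) [MeasurableSpace Ξ] (ν : Measure Ξ) [IsProbabilityMeasure ν]
        (A : Measure (Pt d) → ActiveLearner Ξ d w),
        ENNReal.ofReal (γ * (n : ℝ) ^ (-(α * (β + 1) / (2 * α + d - α * β)))) ≤
          ⨆ P ∈ distClass d α β L C, (A P.marginal).expectedExcessRisk ν n P := by
  have hd0 : (0 : ℝ) < d := lt_of_lt_of_le (by positivity) hαβ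
  have hd : 0 < d := by exact_mod_cast hd0
  set i : Fin d := ⟨0, hd⟩
  have ha : 0 < α / d := by positivity
  have hb : 0 < α / d * β := by positivity
  have hb1 : α / d * β ≤ 1 := by
    rw [div_mul_eq_mul_div, div_le_one hd0]
    exact hαβ
  have hLβ : 1 < L ^ β := Real.one_lt_rpow hL hβ
  set κ : ℝ := L * 2 ^ (α / d - 1) with hκ
  have hκ0 : 0 < κ := by positivity
  -- The bound `δ = (L ^ β - 1) / 2` for `(m - 1) h ^ (1 - b)` leaves room in the margin condition.
  obtain ⟨γ, hγ, H⟩ := exists_scale ha hb hb1 hκ0 (show 0 < (L ^ β - 1) / 2 by linarith)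
  refine ⟨γ, hγ, 1, fun n hn w Ξ _ ν _ A => ?_⟩
  obtain ⟨h, m, hh, hm, h1, h2, h3, h4, h5⟩ := H n hn
  have hexp : (α / d + α / d * β) / (2 * (α / d) + 1 - α / d * β) =
      α * (β + 1) / (2 * α + d - α * β) := by
    have h6 : 2 * α + d - α * β ≠ 0 := by linarith
    have h7 : 2 * (α / d) + 1 - α / d * β ≠ 0 := by linarith
    rw [div_eq_div_iff h7 h6]
    field_simp
    ring
  rw [hexp] at h5
  refine (ENNReal.ofReal_le_ofReal h5).trans ?_
  set S : ENNReal := ⨆ P ∈ distClass d α β L C, (A P.marginal).expectedExcessRisk ν n P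
  have h6 : ∀ σ : Fin m → Bool, (A (segmentMeasure i)).expectedExcessRisk ν n
      (profileDist i (α / d) hκ0.le h σ) ≤ S := fun σ =>
    le_iSup₂_of_le (profileDist i (α / d) hκ0.le h σ)
      (profileDist_mem_distClass hα hα1 hβ hL hC hαβ hm hκ0.le hκ hh (by linarith) σ) le_rfl
  have h7 := ((A (segmentMeasure i)).sum_expectedExcessRisk_ge i hm ha.le hκ0 h2 hh h3 n h4 ν).trans
    (Finset.sum_le_sum fun σ _ => h6 σ)
  rw [ENNReal.ofReal_mul (by positivity)] at h7
  simp only [Finset.sum_const, Finset.card_univ, Fintype.card_pi, Fintype.card_bool,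
    Finset.prod_const, Fintype.card_fin, nsmul_eq_mul] at h7
  have h8 : ENNReal.ofReal ((2 : ℝ) ^ m) = ((2 ^ m : ℕ) : ENNReal) := by
    rw [← ENNReal.ofReal_natCast]
    push_cast
    rfl
  rw [h8] at h7
  exact (ENNReal.mul_le_mul_iff_right (by positivity) (ENNReal.natCast_ne_top _)).1 h7
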